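/- Let $M$ be a (Hausdorff, finite-dimensional, smooth) manifold, $\pi:A\to M$ a smooth real vector bundle of finite rank $n>0$, and $A^*$ its dual. For $a\in\Gamma(A^*)$ let $\iota_a:A\to\mathbb R$ be the corresponding fibrewise linear function. A Jacobi structure on a manifold is a pair $(\Lambda,E)$ of a bivector field and a vector field with $[\Lambda,\Lambda]=-2E\wedge\Lambda$ and $[E,\Lambda]=0$ for the Schouten bracket (with the signs that make it a graded Lie bracket with $[X,f]=X(f)$ and $[P,Q\wedge R]=[P,Q]\wedge R+(-1)^{(p-1)q}Q\wedge[P,R]$ for $P,Q$ of degrees $p,q$); its Jacobi bracket is $\{f,g\}=\Lambda(df,dg)+fE(g)-gE(f)$, and the hamiltonian vector field of $f$ is $X_f=\Lambda(df,\cdot)+fE$. A Jacobi structure on $A$ is strongly-affine if for all smooth fibrewise affine functions $\varphi,\psi$ on $A$ both $\{\varphi,\psi\}$ and $X_\varphi(\psi)$ are fibrewise affine. A Jacobi algebroid structure $((⟦\cdot,\cdot⟧_*,\rho_*),X_0)$ on $A^*$ is a Lie algebroid structure $(⟦\cdot,\cdot⟧_*,\rho_*)$ on $A^*$ with differential $d_*$,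 together with a section $X_0\in\Gamma(A)=\Gamma((A^*)^*)$ such that $d_*X_0=0$. For a section $X$ of $A$, or a skew-symmetric $C^\infty(M)$-bilinear map $P:\Gamma(A^*)\times\Gamma(A^*)\to C^\infty(M)$ (that is, a section of $\wedge^2A$), the vertical lift to $A$ is denoted by $X^v$, $P^v$; $\Delta_A$ is the Liouville vector field of $A$. For every Lie algebroid structure on $A^*$ there is a unique linear Poisson structure $\bar\Lambda_A^*$ on $A$ with $\bar\Lambda_A^*(d\iota_a,d\iota_b)=\iota_{⟦a,b⟧_*}$ for all $a,b\in\Gamma(A^*)$, and every $P$ as above has a unique vertical lift. There is a one-to-one correspondence between - pairs consisting of a Jacobi algebroid structure $((⟦\cdot,\cdot⟧_*,\rho_*),X_0)$ on $A^*$ and a skew-symmetric $C^\infty(M)$-bilinear map $P_0:\Gamma(A^*)\times\Gamma(A^*)\to C^\infty(M)$ with $d_*P_0=-X_0\wedge P_0$, and - strongly-affine Jacobi structures $(\Lambda_A,E_A)$ on $A$, given by $$\Lambda_A=\bar\Lambda_A^*-P_0^v+\Delta_A\wedge X_0^v,\qquad E_A=-X_0^v .$$ Equivalently, for all $a,b\in\Gamma(A^*)$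 and $f,g\in C^\infty(M)$, the Jacobi bracket of affine functions is $$\{\iota_a+f\circ\pi,\ \iota_b+g\circ\pi\}=\iota_{⟦a,b⟧_*}+\bigl(-P_0(a,b)-f\,X_0(b)+g\,X_0(a)-\rho_*(b)(f)+\rho_*(a)(g)\bigr)\circ\pi .$$ -/

import Mathlib

open Bundle Manifold
open scoped ContDiff

noncomputable section

namespace JacobiBundle

/-! ### Multivector calculus on a smooth manifold -/

section Calculus

variable {E : Type*} [NormedAddCommGroup E] [NormedSpace ℝ E]
  {H : Type*} [TopologicalSpace H]

/-- The cotangent space at a point. -/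
abbrev Cotangent (J : ModelWithCorners ℝ E H) {N : Type*} [TopologicalSpace N] [ChartedSpace H N]
    (x : N) : Type _ :=
  TangentSpace J x →L[ℝ] ℝ

/-- Smooth vector fields: smooth sections of the tangent bundle. -/
abbrev VectorField (J : ModelWithCorners ℝ E H) (N : Type*) [TopologicalSpace N]
    [ChartedSpace H N] [IsManifold J ∞ N] : Type _ :=
  Cₛ^∞⟮J; E, fun x : N => TangentSpace J x⟯

/-- A smooth bivector field: an alternating bilinear form on each cotangent space, depending
smoothly on the point. Smoothness is tested on differentials of smooth functions, which on a
Hausdorff finite-dimensional manifold is the same as smoothness of the components in charts. -/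
@[ext]
structure BivectorField (J : ModelWithCorners ℝ E H) (N : Type*) [TopologicalSpace N]
    [ChartedSpace H N] where
  form : ∀ x : N, Cotangent J x →ₗ[ℝ] Cotangent J x →ₗ[ℝ] ℝ
  alternating : ∀ (x : N) (α : Cotangent J x), form x α α = 0
  smooth : ∀ f g : N → ℝ, ContMDiff J 𝓘(ℝ, ℝ) ∞ f → ContMDiff J 𝓘(ℝ, ℝ) ∞ g →
    ContMDiff J 𝓘(ℝ, ℝ) ∞ fun x => form x (mvfderiv J f x) (mvfderiv J g x)

variable {J : ModelWithCorners ℝ E H} {N : Type*} [TopologicalSpace N] [ChartedSpace H N]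
  [IsManifold J ∞ N]

/-- The function `X(f)`. -/
def VectorField.act (X : VectorField J N) (f : N → ℝ) : N → ℝ :=
  fun x => mvfderiv J f x (X x)

/-- The function `Λ(df, dg)`. -/
def BivectorField.onFun (Λ : BivectorField J N) (f g : N → ℝ) : N → ℝ :=
  fun x => Λ.form x (mvfderiv J f x) (mvfderiv J g x)

/-- The Schouten bracket `[Λ, Λ]`, evaluated on `df, dg, dh`. The sign convention is the one for
which `[X, f] = X(f)`, the bracket of vector fields is the commutator, the bracket is a graded Lie
bracket, and `[P, Q ∧ R] = [P, Q] ∧ R + (-1)^((p-1)q) Q ∧ [P, R]`. -/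
def BivectorField.schoutenSelf (Λ : BivectorField J N) (f g h : N → ℝ) : N → ℝ :=
  fun x => -2 * (Λ.onFun (Λ.onFun f g) h x + Λ.onFun (Λ.onFun g h) f x
    + Λ.onFun (Λ.onFun h f) g x)

/-- The Schouten bracket `[X, Λ]`, i.e. the Lie derivative of `Λ` along `X`, evaluated on
`df, dg`. -/
def VectorField.schouten (X : VectorField J N) (Λ : BivectorField J N) (f g : N → ℝ) : N → ℝ :=
  fun x => X.act (Λ.onFun f g) x - Λ.onFun (X.act f) g x - Λ.onFun f (X.act g) x

/-- The trivector field `X ∧ Λ`, evaluated on `df, dg, dh`. -/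
def VectorField.wedge (X : VectorField J N) (Λ : BivectorField J N) (f g h : N → ℝ) : N → ℝ :=
  fun x => X.act f x * Λ.onFun g h x + X.act g x * Λ.onFun h f x + X.act h x * Λ.onFun f g x

variable (J N) in
/-- A Jacobi structure: `[Λ, Λ] = -2 E ∧ Λ` and `[E, Λ] = 0`. -/
@[ext]
structure JacobiStructure where
  Λ : BivectorField J N
  E : VectorField J N
  schouten_self : ∀ f g h : N → ℝ, ContMDiff J 𝓘(ℝ, ℝ) ∞ f → ContMDiff J 𝓘(ℝ, ℝ) ∞ g →
    ContMDiff J 𝓘(ℝ, ℝ) ∞ h → ∀ x, Λ.schoutenSelf f g h x = -2 * VectorField.wedge E Λ f g h x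
  schouten_mixed : ∀ f g : N → ℝ, ContMDiff J 𝓘(ℝ, ℝ) ∞ f → ContMDiff J 𝓘(ℝ, ℝ) ∞ g →
    ∀ x, VectorField.schouten E Λ f g x = 0

/-- The Jacobi bracket `{f, g} = Λ(df, dg) + f E(g) - g E(f)`. -/
def JacobiStructure.bracket (S : JacobiStructure J N) (f g : N → ℝ) : N → ℝ :=
  fun x => S.Λ.onFun f g x + f x * VectorField.act S.E g x - g x * VectorField.act S.E f x

/-- The function `X_f(g)`, where `X_f = #_Λ(df) + f E` is the hamiltonian vector field of `f`. -/
def JacobiStructure.hamiltonianAct (S : JacobiStructure J N) (f g : N → ℝ) : N → ℝ :=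
  fun x => S.Λ.onFun f g x + f x * VectorField.act S.E g x

/-- A Poisson structure: `[Λ, Λ] = 0`. -/
def BivectorField.IsPoisson (Λ : BivectorField J N) : Prop :=
  ∀ f g h : N → ℝ, ContMDiff J 𝓘(ℝ, ℝ) ∞ f → ContMDiff J 𝓘(ℝ, ℝ) ∞ g →
    ContMDiff J 𝓘(ℝ, ℝ) ∞ h → ∀ x, Λ.schoutenSelf f g h x = 0

end Calculus

/-! ### Lie algebroids -/

section Algebroid

variable {E : Type*} [NormedAddCommGroup E] [NormedSpace ℝ E]
  {H : Type*} [TopologicalSpace H] {I : ModelWithCorners ℝ E H}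
  {M : Type*} [TopologicalSpace M] [ChartedSpace H M]
  {G : Type*} [NormedAddCommGroup G] [NormedSpace ℝ G]
  {W : M → Type*} [TopologicalSpace (TotalSpace G W)]
  [∀ x, AddCommGroup (W x)] [∀ x, Module ℝ (W x)] [∀ x, TopologicalSpace (W x)]
  [FiberBundle G W] [VectorBundle ℝ G W]

/-- The product of a smooth function and a smooth section. -/
def smulSection (f : C^∞⟮I, M; ℝ⟯) (s : Cₛ^∞⟮I; G, W⟯) : Cₛ^∞⟮I; G, W⟯ :=
  ⟨fun x => f x • s x, f.contMDiff.smul_section s.contMDiff⟩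

variable [∀ x, IsTopologicalAddGroup (W x)] [∀ x, ContinuousSMul ℝ (W x)] [IsManifold I ∞ M]

variable (I G W) in
/-- A Lie algebroid structure on the vector bundle `W → M`: a real Lie algebra structure on the
smooth sections, and an anchor (a smooth vector bundle morphism `W → TM` over the identity)
satisfying the Leibniz rule. -/
@[ext]
structure LieAlgebroid where
  bracket : Cₛ^∞⟮I; G, W⟯ → Cₛ^∞⟮I; G, W⟯ → Cₛ^∞⟮I; G, W⟯
  anchor : Cₛ^∞⟮I; G →L[ℝ] E, fun x : M => W x →L[ℝ] TangentSpace I x⟯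
  bracket_add : ∀ a b c, bracket a (b + c) = bracket a b + bracket a c
  bracket_smul : ∀ (r : ℝ) a b, bracket a (r • b) = r • bracket a b
  bracket_skew : ∀ a b, bracket a b = -bracket b a
  jacobi : ∀ a b c,
    bracket (bracket a b) c + bracket (bracket b c) a + bracket (bracket c a) b = 0
  leibniz : ∀ a (f : C^∞⟮I, M; ℝ⟯) b (x : M),
    bracket a (smulSection f b) x
      = f x • bracket a b x + (mvfderiv I f x (anchor x (a x)) : ℝ) • b x

/-- The function `ρ(a)(f)`. -/
def LieAlgebroid.rho (L : LieAlgebroid I G W) (a : Cₛ^∞⟮I; G, W⟯) (f : M → ℝ) : M → ℝ :=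
  fun x => mvfderiv I f x (L.anchor x (a x))

/-- The Lie algebroid differential of a 1-form, given as a map on sections. -/
def LieAlgebroid.d₁ (L : LieAlgebroid I G W) (φ : Cₛ^∞⟮I; G, W⟯ → M → ℝ)
    (a b : Cₛ^∞⟮I; G, W⟯) : M → ℝ :=
  fun x => L.rho a (φ b) x - L.rho b (φ a) x - φ (L.bracket a b) x

/-- The Lie algebroid differential of a 2-form, given as a map on pairs of sections. -/
def LieAlgebroid.d₂ (L : LieAlgebroid I G W) (P : Cₛ^∞⟮I; G, W⟯ → Cₛ^∞⟮I; G, W⟯ → M → ℝ)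
    (a b c : Cₛ^∞⟮I; G, W⟯) : M → ℝ :=
  fun x => L.rho a (P b c) x - L.rho b (P a c) x + L.rho c (P a b) x
    - P (L.bracket a b) c x + P (L.bracket a c) b x - P (L.bracket b c) a x

/-- The wedge product of a 1-form and a 2-form. -/
def wedge₁₂ (φ : Cₛ^∞⟮I; G, W⟯ → M → ℝ) (P : Cₛ^∞⟮I; G, W⟯ → Cₛ^∞⟮I; G, W⟯ → M → ℝ)
    (a b c : Cₛ^∞⟮I; G, W⟯) : M → ℝ :=
  fun x => φ a x * P b c x - φ b x * P a c x + φ c x * P a b x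

variable (I G W) in
/-- A skew-symmetric `C^∞(M)`-bilinear map `Γ(W) × Γ(W) → C^∞(M)`. -/
@[ext]
structure SkewBilinear where
  toFun : Cₛ^∞⟮I; G, W⟯ → Cₛ^∞⟮I; G, W⟯ → C^∞⟮I, M; ℝ⟯
  skew : ∀ a b, toFun a b = -toFun b a
  map_add : ∀ a b c, toFun a (b + c) = toFun a b + toFun a c
  map_smul : ∀ a (f : C^∞⟮I, M; ℝ⟯) b, toFun a (smulSection f b) = f * toFun a b

end Algebroid

/-! ### Structures on the total space of a vector bundle `A = TotalSpace F V → M` -/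

section TotalSpace

variable {E : Type*} [NormedAddCommGroup E] [NormedSpace ℝ E]
  {H : Type*} [TopologicalSpace H] {I : ModelWithCorners ℝ E H}
  {M : Type*} [TopologicalSpace M] [ChartedSpace H M] [IsManifold I ∞ M]
  {F : Type*} [NormedAddCommGroup F] [NormedSpace ℝ F]
  {V : M → Type*} [TopologicalSpace (TotalSpace F V)]
  [∀ x, AddCommGroup (V x)] [∀ x, Module ℝ (V x)] [∀ x, TopologicalSpace (V x)]
  [∀ x, IsTopologicalAddGroup (V x)] [∀ x, ContinuousSMul ℝ (V x)]
  [FiberBundle F V] [VectorBundle ℝ F V] [ContMDiffVectorBundle ∞ F V I]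

/-- The fibres of the dual bundle `A^*`. -/
abbrev DualFiber (V : M → Type*) [∀ x, AddCommGroup (V x)] [∀ x, Module ℝ (V x)]
    [∀ x, TopologicalSpace (V x)] (x : M) : Type _ :=
  V x →L[ℝ] Bundle.Trivial M ℝ x

variable (I F V) in
/-- Smooth sections of the dual bundle `A^*`. -/
abbrev DualSection : Type _ := Cₛ^∞⟮I; F →L[ℝ] ℝ, DualFiber V⟯

/-- The function `⟨a, X⟩` on `M`, for a section `X` of `A` and a section `a` of `A^*`. -/
def pairing (X : Cₛ^∞⟮I; F, V⟯) (a : DualSection I F V) : M → ℝ := fun x => a x (X x)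

/-- The fibrewise linear function `ι_a` on `A` given by a section `a` of `A^*`. -/
def linFun (a : DualSection I F V) : TotalSpace F V → ℝ := fun v => a v.proj v.snd

variable (I) in
/-- Smooth functions on `A` that are affine on each fibre. -/
def IsAffineFun (a : TotalSpace F V → ℝ) : Prop :=
  ContMDiff (I.prod 𝓘(ℝ, F)) 𝓘(ℝ, ℝ) ∞ a ∧
    ∀ x : M, ∃ (φ : V x →ₗ[ℝ] ℝ) (c : ℝ), ∀ w : V x, a ⟨x, w⟩ = φ w + c

variable (I) in
/-- Smooth functions on `A` that are linear on each fibre. -/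
def IsLinearFun (a : TotalSpace F V → ℝ) : Prop :=
  ContMDiff (I.prod 𝓘(ℝ, F)) 𝓘(ℝ, ℝ) ∞ a ∧
    ∀ x : M, ∃ φ : V x →ₗ[ℝ] ℝ, ∀ w : V x, a ⟨x, w⟩ = φ w

variable (I F) in
/-- The vertical lift of `w` to the point `v` of the same fibre: the velocity at `t = 0` of the
curve `t ↦ v + t w`. -/
def verticalLift (v : TotalSpace F V) (w : V v.proj) : TangentSpace (I.prod 𝓘(ℝ, F)) v :=
  mfderiv 𝓘(ℝ, ℝ) (I.prod 𝓘(ℝ, F))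
    (fun t : ℝ => (⟨v.proj, v.snd + t • w⟩ : TotalSpace F V)) 0 (1 : ℝ)

variable (I) in
/-- The Liouville vector field, whose value at `v` is the vertical lift of `v` itself. -/
def liouville (v : TotalSpace F V) : TangentSpace (I.prod 𝓘(ℝ, F)) v :=
  verticalLift I F v v.snd

/-- The vertical lift `X^v` of a section `X` of `A`. -/
def sectionLift (X : Cₛ^∞⟮I; F, V⟯) (v : TotalSpace F V) : TangentSpace (I.prod 𝓘(ℝ, F)) v :=
  verticalLift I F v (X v.proj)

/-- `B` is the vertical lift `P^v` of the 2-section `P` of `A`. -/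
def SkewBilinear.IsVerticalLift (P : SkewBilinear I (F →L[ℝ] ℝ) (DualFiber V))
    (B : BivectorField (I.prod 𝓘(ℝ, F)) (TotalSpace F V)) : Prop :=
  (∀ (a b : DualSection I F V) (v : TotalSpace F V),
    B.onFun (linFun a) (linFun b) v = P.toFun a b v.proj) ∧
  ∀ (f : C^∞⟮I, M; ℝ⟯) (g : TotalSpace F V → ℝ),
    ContMDiff (I.prod 𝓘(ℝ, F)) 𝓘(ℝ, ℝ) ∞ g →
    ∀ v : TotalSpace F V, B.onFun (fun u => f u.proj) g v = 0

/-- `B` is the linear Poisson structure on `A` induced by a Lie algebroid structure on `A^*`. -/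
def LieAlgebroid.IsInducedPoisson (L : LieAlgebroid I (F →L[ℝ] ℝ) (DualFiber V))
    (B : BivectorField (I.prod 𝓘(ℝ, F)) (TotalSpace F V)) : Prop :=
  B.IsPoisson ∧
  (∀ f g : TotalSpace F V → ℝ, IsLinearFun I f → IsLinearFun I g →
    IsLinearFun I (B.onFun f g)) ∧
  ∀ (a b : DualSection I F V) (v : TotalSpace F V),
    B.onFun (linFun a) (linFun b) v = linFun (L.bracket a b) v

variable (I F V) in
/-- A strongly-affine Jacobi structure on `A`: the Jacobi bracket of two affine functions is
affine, and the hamiltonian vector field of an affine function is affine, i.e. it maps affine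
functions to affine functions. -/
@[ext]
structure StronglyAffineJacobi extends JacobiStructure (I.prod 𝓘(ℝ, F)) (TotalSpace F V) where
  affine : ∀ a b : TotalSpace F V → ℝ, IsAffineFun I a → IsAffineFun I b →
    IsAffineFun I (toJacobiStructure.bracket a b)
  hamiltonian_affine : ∀ a b : TotalSpace F V → ℝ, IsAffineFun I a → IsAffineFun I b →
    IsAffineFun I (toJacobiStructure.hamiltonianAct a b)

variable (I F V) in
/-- A Jacobi algebroid structure on `A^*`: a Lie algebroid structure together with a 1-cocycle,
which is a section of `(A^*)^* = A`. -/
@[ext]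
structure DualJacobiAlgebroid extends LieAlgebroid I (F →L[ℝ] ℝ) (DualFiber V) where
  X₀ : Cₛ^∞⟮I; F, V⟯
  cocycle : ∀ a b x, toLieAlgebroid.d₁ (pairing X₀) a b x = 0

variable (I F V) in
/-- A Jacobi algebroid structure on `A^*` together with a skew-symmetric `C^∞(M)`-bilinear map
`P₀` such that `d_* P₀ = -X₀ ∧ P₀`. -/
@[ext]
structure TwistedJacobiAlgebroid extends DualJacobiAlgebroid I F V where
  P₀ : SkewBilinear I (F →L[ℝ] ℝ) (DualFiber V)
  twist : ∀ a b c x, toLieAlgebroid.d₂ (fun s t => P₀.toFun s t) a b c x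
    = -wedge₁₂ (pairing X₀) (fun s t => P₀.toFun s t) a b c x

end TotalSpace

end JacobiBundle

end

/-!
Around every point of `A` the fibrewise affine functions contain local coordinates, so bivector
fields, vector fields and Jacobi structures on `A` are determined by their values on affine
functions, and conversely may be prescribed there as long as the prescription at a point depends
only on differentials. Affine functions are sections of `A^* ⊕ ℝ`. For a strongly-affine Jacobi
structure, products of the form `p · E(q)` and `p · Λ(f ∘ π, q)` with `p`, `q` affine are again
affine, which forces `E(q)` and `Λ(f ∘ π, q)` to be constant on the fibres. The Jacobi bracket on
`Γ(A^* ⊕ ℝ)` is thereby built from a bracket, an anchor, a section `X₀` and a 2-section `P₀`, and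
its Jacobi identity splits into the Jacobi identity of the bracket, `d_* X₀ = 0` and
`d_* P₀ = -X₀ ∧ P₀`. The rank enters through the fact that a function annihilated by all `ι_a`
vanishes, so that linear functions alone already determine a bivector field.
-/

noncomputable section

namespace JacobiBundle

open Filter Topology

/-! ### Local calculus -/

section LocalCalculus

variable {E : Type*} [NormedAddCommGroup E] [NormedSpace ℝ E]
  {H : Type*} [TopologicalSpace H] {J : ModelWithCorners ℝ E H}
  {N : Type*} [TopologicalSpace N] [ChartedSpace H N]
  {G : Type*} [NormedAddCommGroup G] [NormedSpace ℝ G]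

theorem mvfderiv_congr_of_eventuallyEq {f g : N → G} {x : N} (h : f =ᶠ[𝓝 x] g) :
    mvfderiv J f x = mvfderiv J g x := by
  ext v
  simp only [mvfderiv, h.mfderiv_eq]
  rfl

theorem mvfderiv_comp_of_differentiableAt {G' : Type*} [NormedAddCommGroup G'] [NormedSpace ℝ G']
    {g : G → G'} {f : N → G} {x : N} (hg : DifferentiableAt ℝ g (f x))
    (hf : MDifferentiableAt J 𝓘(ℝ, G) f x) :
    mvfderiv J (fun y => g (f y)) x = (fderiv ℝ g (f x)).comp (mvfderiv J f x) := by
  ext v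
  have h : mfderiv J 𝓘(ℝ, G') (g ∘ f) x = _ := mfderiv_comp x hg.mdifferentiableAt hf
  rw [mfderiv_eq_fderiv] at h
  exact DFunLike.congr_fun h v

theorem mvfderiv_clm_apply_of_eq_zero {T : N → G →L[ℝ] ℝ} {ξ : N → G} {x : N}
    (hT : MDifferentiableAt J 𝓘(ℝ, G →L[ℝ] ℝ) T x) (hξ : MDifferentiableAt J 𝓘(ℝ, G) ξ x)
    (h0 : T x = 0) (v : TangentSpace J x) :
    mvfderiv J (fun y => T y (ξ y)) x v = mvfderiv J T x v (ξ x) := by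
  have hpair := hT.prodMk_space hξ
  have hfst : mvfderiv J T x v = (mvfderiv J (fun y => (T y, ξ y)) x v).1 := by
    have h := mvfderiv_comp_of_differentiableAt (g := Prod.fst) differentiableAt_fst hpair
    rw [fderiv_fst] at h
    exact DFunLike.congr_fun h v
  have happly : fderiv ℝ (fun p : (G →L[ℝ] ℝ) × G => p.1 p.2) (T x, ξ x) =
      (ContinuousLinearMap.fst ℝ (G →L[ℝ] ℝ) G).flip (ξ x) := by
    rw [fderiv_clm_apply differentiableAt_fst differentiableAt_snd, fderiv_fst, h0]
    simp
  rw [mvfderiv_comp_of_differentiableAt (f := fun y => (T y, ξ y))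
    (g := fun p : (G →L[ℝ] ℝ) × G => p.1 p.2)
    (differentiableAt_fst.clm_apply differentiableAt_snd) hpair, happly, hfst]
  rfl

theorem mvfderiv_clm_comp (c : G →L[ℝ] ℝ) {f : N → G} {x : N}
    (hf : MDifferentiableAt J 𝓘(ℝ, G) f x) :
    mvfderiv J (fun y => c (f y)) x = c.comp (mvfderiv J f x) := by
  rw [mvfderiv_comp_of_differentiableAt c.differentiableAt hf, c.fderiv]

/-- The derivative of `f` read in the chart at `x₀`: the partial derivatives of `f` with respect
to the coordinates centred at `x₀`, as a function on `N`. -/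
def coordDeriv (J : ModelWithCorners ℝ E H) (x₀ : N) (f : N → ℝ) (x : N) : E →L[ℝ] ℝ :=
  fderiv ℝ (f ∘ (extChartAt J x₀).symm) (extChartAt J x₀ x)

variable [IsManifold J ∞ N]

theorem mvfderiv_extChartAt_self_apply (x : N) (v : TangentSpace J x) :
    mvfderiv J (extChartAt J x) x v = v := by
  simp only [mvfderiv, mfderiv_extChartAt_self]
  rfl

theorem snd_trivializationAt_tangentSpace {x₀ x : N} (hx : x ∈ (chartAt H x₀).source)
    (v : TangentSpace J x) :
    (trivializationAt E (TangentSpace J) x₀ ⟨x, v⟩).2 = mvfderiv J (extChartAt J x₀) x v := by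
  rw [← Trivialization.continuousLinearMapAt_apply_of_mem ℝ _ (by simpa using hx),
    TangentBundle.continuousLinearMapAt_trivializationAt hx]
  rfl

theorem contMDiffAt_vectorField_iff {Y : ∀ x : N, TangentSpace J x} {x₀ : N} :
    ContMDiffAt J (J.prod 𝓘(ℝ, E)) ∞ (fun x => TotalSpace.mk' E x (Y x)) x₀ ↔
      ContMDiffAt J 𝓘(ℝ, E) ∞ (fun x => mvfderiv J (extChartAt J x₀) x (Y x)) x₀ := by
  rw [contMDiffAt_section]
  refine EventuallyEq.contMDiffAt_iff ?_
  filter_upwards [(chartAt H x₀).open_source.mem_nhds (mem_chart_source H x₀)] with x hx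
  exact snd_trivializationAt_tangentSpace hx (Y x)

variable [J.Boundaryless] {f : N → ℝ}

theorem contDiffAt_comp_extChartAt_symm (hf : ContMDiff J 𝓘(ℝ, ℝ) ∞ f) (x₀ : N) {z : E}
    (hz : z ∈ (extChartAt J x₀).target) :
    ContDiffAt ℝ ∞ (f ∘ (extChartAt J x₀).symm) z := by
  have h := hf.comp_contMDiffOn (contMDiffOn_extChartAt_symm (n := ∞) x₀)
  exact (contMDiffOn_iff_contDiffOn.1 h).contDiffAt ((isOpen_extChartAt_target x₀).mem_nhds hz)

theorem contMDiffAt_coordDeriv (hf : ContMDiff J 𝓘(ℝ, ℝ) ∞ f) (x₀ : N) :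
    ContMDiffAt J 𝓘(ℝ, E →L[ℝ] ℝ) ∞ (coordDeriv J x₀ f) x₀ := by
  have h := (contDiffAt_comp_extChartAt_symm hf x₀ (mem_extChartAt_target x₀)).fderiv_right
    (m := ∞) (by simp)
  exact h.contMDiffAt.comp x₀ contMDiffAt_extChartAt

theorem mvfderiv_eq_coordDeriv_comp (hf : ContMDiff J 𝓘(ℝ, ℝ) ∞ f) {x₀ x : N}
    (hx : x ∈ (chartAt H x₀).source) :
    mvfderiv J f x = (coordDeriv J x₀ f x).comp (mvfderiv J (extChartAt J x₀) x) := by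
  have hx' : x ∈ (extChartAt J x₀).source := by rwa [extChartAt_source]
  have hd := (contDiffAt_comp_extChartAt_symm hf x₀
    ((extChartAt J x₀).map_source hx')).differentiableAt (by simp)
  have hev : f =ᶠ[𝓝 x] fun u => (f ∘ (extChartAt J x₀).symm) (extChartAt J x₀ u) := by
    filter_upwards [(isOpen_extChartAt_source x₀).mem_nhds hx'] with u hu
    exact congrArg f ((extChartAt J x₀).left_inv hu).symm
  rw [mvfderiv_congr_of_eventuallyEq hev,
    mvfderiv_comp_of_differentiableAt hd (mdifferentiableAt_extChartAt hx)]
  rfl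

theorem mvfderiv_eq_coordDeriv (hf : ContMDiff J 𝓘(ℝ, ℝ) ∞ f) (x : N) :
    mvfderiv J f x = coordDeriv J x f x := by
  rw [mvfderiv_eq_coordDeriv_comp hf (mem_chart_source H x)]
  ext v
  exact congrArg (coordDeriv J x f x) (mvfderiv_extChartAt_self_apply x v)

theorem mvfderiv_act_of_mvfderiv_eq_zero (X : VectorField J N) (hf : ContMDiff J 𝓘(ℝ, ℝ) ∞ f)
    {x : N} (h0 : mvfderiv J f x = 0) (v : TangentSpace J x) :
    mvfderiv J (X.act f) x v =
      fderiv ℝ (fderiv ℝ (f ∘ (extChartAt J x).symm)) (extChartAt J x x) v (X x) := by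
  have hf₂ : DifferentiableAt ℝ (fderiv ℝ (f ∘ (extChartAt J x).symm)) (extChartAt J x x) :=
    ((contDiffAt_comp_extChartAt_symm hf x (mem_extChartAt_target x)).fderiv_right
      (m := 1) (by norm_cast)).differentiableAt (by simp)
  have hX : X.act f =ᶠ[𝓝 x]
      fun y => coordDeriv J x f y (mvfderiv J (extChartAt J x) y (X y)) := by
    filter_upwards [(chartAt H x).open_source.mem_nhds (mem_chart_source H x)] with y hy
    exact DFunLike.congr_fun (mvfderiv_eq_coordDeriv_comp hf hy) (X y)
  rw [mvfderiv_congr_of_eventuallyEq hX, mvfderiv_clm_apply_of_eq_zero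
    ((contMDiffAt_coordDeriv hf x).mdifferentiableAt (by simp))
    ((contMDiffAt_vectorField_iff.1 (X.contMDiff x)).mdifferentiableAt (by simp))
    (by rw [← mvfderiv_eq_coordDeriv hf, h0]; rfl), mvfderiv_extChartAt_self_apply]
  unfold coordDeriv
  rw [mvfderiv_comp_of_differentiableAt hf₂
    (mdifferentiableAt_extChartAt (mem_chart_source H x))]
  exact congrArg (fun w => fderiv ℝ (fderiv ℝ (f ∘ (extChartAt J x).symm)) (extChartAt J x x) w
    (X x)) (mvfderiv_extChartAt_self_apply x v)

theorem act_act_comm_of_mvfderiv_eq_zero (X Y : VectorField J N)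
    (hf : ContMDiff J 𝓘(ℝ, ℝ) ∞ f) {x : N} (h0 : mvfderiv J f x = 0) :
    X.act (Y.act f) x = Y.act (X.act f) x := by
  have hsymm : IsSymmSndFDerivAt ℝ (f ∘ (extChartAt J x).symm) (extChartAt J x x) :=
    (contDiffAt_comp_extChartAt_symm hf x (mem_extChartAt_target x)).isSymmSndFDerivAt
      (by simp; norm_cast)
  calc X.act (Y.act f) x = _ := mvfderiv_act_of_mvfderiv_eq_zero Y hf h0 (X x)
    _ = _ := hsymm (X x) (Y x)
    _ = Y.act (X.act f) x := (mvfderiv_act_of_mvfderiv_eq_zero X hf h0 (Y x)).symm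

end LocalCalculus

/-! ### Jacobi brackets and derivations -/

section DerivationAlgebra

variable {R A : Type*} [CommRing R] [CommRing A] [Algebra R A]

/-- The Jacobi bracket `{f, g} = Λ(f, g) + f X(g) - g X(f)` of a biderivation `Λ` and a derivation
`X` of a commutative algebra. -/
def derivationBracket (Λ : A →ₗ[R] Derivation R A A) (X : Derivation R A A) (f g : A) : A :=
  Λ f g + f * X g - g * X f

/-- The cyclic sum `{{f, g}, h} + {{g, h}, f} + {{h, f}, g}` of a bracket. -/
def jacobiator {B : Type*} [Add B] (b : B → B → B) (f g h : B) : B :=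
  b (b f g) h + b (b g h) f + b (b h f) g

/-- The algebraic counterpart of `-½ ([Λ, Λ] + 2 X ∧ Λ)`, evaluated on `df, dg, dh`. -/
def selfDefect (Λ : A →ₗ[R] Derivation R A A) (X : Derivation R A A) (f g h : A) : A :=
  Λ (Λ f g) h + Λ (Λ g h) f + Λ (Λ h f) g - (X f * Λ g h + X g * Λ h f + X h * Λ f g)

/-- The algebraic counterpart of `[X, Λ]`, evaluated on `df, dg`. -/
def mixedDefect (Λ : A →ₗ[R] Derivation R A A) (X : Derivation R A A) (f g : A) : A :=
  X (Λ f g) - Λ (X f) g - Λ f (X g)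

variable {Λ : A →ₗ[R] Derivation R A A} {X : Derivation R A A}

theorem leibniz_left (hΛ : ∀ f g, Λ f g = -Λ g f) (f g h : A) :
    Λ (f * g) h = f * Λ g h + g * Λ f h := by
  rw [hΛ, Derivation.leibniz, hΛ h f, hΛ h g]
  simp only [smul_eq_mul]
  ring

theorem jacobiator_derivationBracket (hΛ : ∀ f g, Λ f g = -Λ g f) (f g h : A) :
    jacobiator (derivationBracket Λ X) f g h = selfDefect Λ X f g h
        - (f * mixedDefect Λ X g h + g * mixedDefect Λ X h f + h * mixedDefect Λ X f g) := by
  simp only [jacobiator, derivationBracket, selfDefect, mixedDefect, map_add, map_sub,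
    Derivation.add_apply, Derivation.sub_apply, Derivation.leibniz, smul_eq_mul,
    leibniz_left hΛ]
  rw [hΛ g (X h), hΛ h (X f), hΛ f (X g), hΛ f h, hΛ h g, hΛ g f]
  ring

theorem mixedDefect_eq_zero_of_jacobiator (hΛ : ∀ f g, Λ f g = -Λ g f) {f g : A}
    (h : jacobiator (derivationBracket Λ X) f g 1 = 0) : mixedDefect Λ X f g = 0 := by
  have hone : ∀ f, Λ 1 f = 0 := fun f => by rw [hΛ, Derivation.map_one_eq_zero, neg_zero]
  have hself : selfDefect Λ X f g 1 = 0 := by simp [selfDefect, hone]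
  have hvanish : ∀ f, mixedDefect Λ X f 1 = 0 ∧ mixedDefect Λ X 1 f = 0 := fun f => by
    simp [mixedDefect, hone]
  simpa [jacobiator_derivationBracket hΛ, hself, hvanish] using h

theorem mixedDefect_skew (hΛ : ∀ f g, Λ f g = -Λ g f) (f g : A) :
    mixedDefect Λ X f g = -mixedDefect Λ X g f := by
  simp only [mixedDefect, hΛ f, hΛ (X f), map_neg]
  ring

theorem mixedDefect_sub_right (f g h : A) :
    mixedDefect Λ X f (g - h) = mixedDefect Λ X f g - mixedDefect Λ X f h := by
  simp only [mixedDefect, map_sub]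
  ring

theorem selfDefect_rotate (f g h : A) : selfDefect Λ X f g h = selfDefect Λ X h f g := by
  simp only [selfDefect]
  ring

theorem selfDefect_sub_right (f g h k : A) :
    selfDefect Λ X f g (h - k) = selfDefect Λ X f g h - selfDefect Λ X f g k := by
  simp only [selfDefect, map_sub, Derivation.sub_apply]
  ring

end DerivationAlgebra

section ManifoldDerivations

variable {E : Type*} [NormedAddCommGroup E] [NormedSpace ℝ E]
  {H : Type*} [TopologicalSpace H] {J : ModelWithCorners ℝ E H}
  {N : Type*} [TopologicalSpace N] [ChartedSpace H N]

theorem mvfderiv_smoothMap_add (f g : C^∞⟮J, N; ℝ⟯) (x : N) :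
    mvfderiv J (f + g) x = mvfderiv J f x + mvfderiv J g x := by
  rw [ContMDiffMap.coe_add]
  exact mvfderiv_add ((f.contMDiff x).mdifferentiableAt (by simp))
    ((g.contMDiff x).mdifferentiableAt (by simp))

theorem mvfderiv_smoothMap_mul (f g : C^∞⟮J, N; ℝ⟯) (x : N) :
    mvfderiv J (f * g) x = f x • mvfderiv J g x + g x • mvfderiv J f x := by
  rw [ContMDiffMap.coe_mul]
  exact mvfderiv_mul ((f.contMDiff x).mdifferentiableAt (by simp))
    ((g.contMDiff x).mdifferentiableAt (by simp))

theorem mvfderiv_smoothMap_smul (r : ℝ) (f : C^∞⟮J, N; ℝ⟯) (x : N) :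
    mvfderiv J (r • f) x = r • mvfderiv J f x := by
  have h := mvfderiv_smoothMap_mul (ContMDiffMap.const r) f x
  rw [show mvfderiv J (ContMDiffMap.const r : C^∞⟮J, N; ℝ⟯) x = 0 from mvfderiv_const r,
    smul_zero, add_zero] at h
  exact h

theorem mvfderiv_smoothMap_sub (f g : C^∞⟮J, N; ℝ⟯) (x : N) :
    mvfderiv J (f - g) x = mvfderiv J f x - mvfderiv J g x := by
  rw [ContMDiffMap.coe_sub]
  exact mvfderiv_sub ((f.contMDiff x).mdifferentiableAt (by simp))
    ((g.contMDiff x).mdifferentiableAt (by simp))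

theorem BivectorField.form_skew (Λ : BivectorField J N) (x : N) (α β : Cotangent J x) :
    Λ.form x α β = -Λ.form x β α := by
  have h := Λ.alternating x (α + β)
  simp only [map_add, LinearMap.add_apply, Λ.alternating] at h
  linarith

/-- The biderivation `(f, g) ↦ Λ(df, dg)` of the algebra of smooth functions. -/
def BivectorField.biderivation (Λ : BivectorField J N) :
    C^∞⟮J, N; ℝ⟯ →ₗ[ℝ] Derivation ℝ C^∞⟮J, N; ℝ⟯ C^∞⟮J, N; ℝ⟯ where
  toFun f := Derivation.mk'
    { toFun g := ⟨Λ.onFun f g, Λ.smooth f g f.contMDiff g.contMDiff⟩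
      map_add' g h := by
        ext x
        exact (congrArg (Λ.form x _) (mvfderiv_smoothMap_add g h x)).trans
          (map_add (Λ.form x _) _ _)
      map_smul' r g := by
        ext x
        exact (congrArg (Λ.form x _) (mvfderiv_smoothMap_smul r g x)).trans
          (map_smul (Λ.form x _) _ _) }
    fun g h => by
      ext x
      refine (congrArg (Λ.form x _) (mvfderiv_smoothMap_mul g h x)).trans ?_
      refine (map_add (Λ.form x _) _ _).trans (congrArg₂ (· + ·) ?_ ?_) <;>
        exact map_smul (Λ.form x _) _ _
  map_add' f g := by
    ext h x
    exact LinearMap.congr_fun ((congrArg (Λ.form x) (mvfderiv_smoothMap_add f g x)).trans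
      (map_add _ _ _)) _
  map_smul' r f := by
    ext h x
    exact LinearMap.congr_fun ((congrArg (Λ.form x) (mvfderiv_smoothMap_smul r f x)).trans
      (map_smul _ _ _)) _

theorem BivectorField.biderivation_skew (Λ : BivectorField J N) (f g : C^∞⟮J, N; ℝ⟯) :
    Λ.biderivation f g = -Λ.biderivation g f :=
  ContMDiffMap.ext fun x => Λ.form_skew x (mvfderiv J f x) (mvfderiv J g x)

variable [IsManifold J ∞ N] [J.Boundaryless]

theorem VectorField.contMDiff_act (X : VectorField J N) {f : N → ℝ}
    (hf : ContMDiff J 𝓘(ℝ, ℝ) ∞ f) : ContMDiff J 𝓘(ℝ, ℝ) ∞ (X.act f) := by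
  intro x₀
  refine ((contMDiffAt_coordDeriv hf x₀).clm_apply
    (contMDiffAt_vectorField_iff.1 (X.contMDiff x₀))).congr_of_eventuallyEq ?_
  filter_upwards [(chartAt H x₀).open_source.mem_nhds (mem_chart_source H x₀)] with x hx
  exact DFunLike.congr_fun (mvfderiv_eq_coordDeriv_comp hf hx) (X x)

/-- The derivation `f ↦ X(f)` of the algebra of smooth functions. -/
def VectorField.derivation (X : VectorField J N) :
    Derivation ℝ C^∞⟮J, N; ℝ⟯ C^∞⟮J, N; ℝ⟯ := Derivation.mk'
  { toFun f := ⟨X.act f, X.contMDiff_act f.contMDiff⟩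
    map_add' f g := by
      ext x
      exact DFunLike.congr_fun (mvfderiv_smoothMap_add f g x) (X x)
    map_smul' r f := by
      ext x
      exact DFunLike.congr_fun (mvfderiv_smoothMap_smul r f x) (X x) }
  fun f g => by
    ext x
    exact DFunLike.congr_fun (mvfderiv_smoothMap_mul f g x) (X x)

end ManifoldDerivations

/-! ### Coordinate families -/

theorem exists_eval_eq {G : Type*} [AddCommGroup G] [Module ℝ G] [TopologicalSpace G]
    [IsTopologicalAddGroup G] [ContinuousSMul ℝ G] [T2Space G] [FiniteDimensional ℝ G]
    (θ : (G →L[ℝ] ℝ) →ₗ[ℝ] ℝ) : ∃ v : G, ∀ α : G →L[ℝ] ℝ, α v = θ α := by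
  obtain ⟨v, hv⟩ := (Module.evalEquiv ℝ G).surjective
    (θ.comp LinearMap.toContinuousLinearMap.toLinearMap)
  exact ⟨v, fun α => LinearMap.congr_fun hv α.toLinearMap⟩

theorem exists_form_comp_eq {P Q : Type*} [AddCommGroup P] [Module ℝ P] [AddCommGroup Q]
    [Module ℝ Q] {d : P →ₗ[ℝ] Q} (hd : Function.Surjective d) {B : P →ₗ[ℝ] P →ₗ[ℝ] ℝ}
    (halt : ∀ p, B p p = 0) (hker : ∀ p q, d q = 0 → B p q = 0) :
    ∃ C : Q →ₗ[ℝ] Q →ₗ[ℝ] ℝ, (∀ α, C α α = 0) ∧ ∀ p q, C (d p) (d q) = B p q := by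
  obtain ⟨s, hs⟩ := d.exists_rightInverse_of_surjective (LinearMap.range_eq_top.2 hd)
  have hright : ∀ p q, B p (s (d q)) = B p q := fun p q => by
    rw [← sub_eq_zero, ← map_sub]
    exact hker p _ (by rw [map_sub, sub_eq_zero]; exact LinearMap.congr_fun hs (d q))
  refine ⟨B.compl₁₂ s s, fun α => halt _, fun p q => ?_⟩
  rw [LinearMap.compl₁₂_apply, hright, ← LinearMap.IsAlt.neg halt, hright, LinearMap.IsAlt.neg halt]

section CoordinateFamily

variable {E : Type*} [NormedAddCommGroup E] [NormedSpace ℝ E]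
  {H : Type*} [TopologicalSpace H] {J : ModelWithCorners ℝ E H}
  {N : Type*} [TopologicalSpace N] [ChartedSpace H N]

variable (J) in
/-- The differential `f ↦ d_x f` at a point, as a linear map on smooth functions. -/
def differentialAt (x : N) : C^∞⟮J, N; ℝ⟯ →ₗ[ℝ] Cotangent J x where
  toFun f := mvfderiv J f x
  map_add' f g := mvfderiv_smoothMap_add f g x
  map_smul' r f := mvfderiv_smoothMap_smul r f x

/-- A set of globally smooth functions from which local coordinates can be drawn: near each point
the preferred chart extends to a smooth map `Ψ` on the whole manifold whose components
belong to the set. Tensor fields are determined by, and can be tested on, such a family. -/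
def IsCoordinateFamily (𝒜 : Set C^∞⟮J, N; ℝ⟯) : Prop :=
  ∀ x₀ : N, ∃ Ψ : C^∞⟮J, N; 𝓘(ℝ, E), E⟯, Ψ =ᶠ[𝓝 x₀] extChartAt J x₀ ∧
    ∀ c : E →L[ℝ] ℝ, ∃ f ∈ 𝒜, ∀ x, f x = c (Ψ x)

namespace IsCoordinateFamily

variable {𝒜 : Set C^∞⟮J, N; ℝ⟯}

section Pointwise

variable [IsManifold J ∞ N]

theorem exists_mvfderiv_eq (h𝒜 : IsCoordinateFamily 𝒜) (x : N) (α : Cotangent J x) :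
    ∃ f ∈ 𝒜, mvfderiv J f x = α := by
  obtain ⟨Ψ, hΨ, hcomp⟩ := h𝒜 x
  obtain ⟨f, hf, hfΨ⟩ := hcomp α
  refine ⟨f, hf, ?_⟩
  rw [funext hfΨ, mvfderiv_clm_comp (G := E) α ((Ψ.contMDiff x).mdifferentiableAt (by simp)),
    mvfderiv_congr_of_eventuallyEq hΨ]
  ext v
  exact congrArg α (mvfderiv_extChartAt_self_apply x v)

theorem eq_zero_of_forall_mem (h𝒜 : IsCoordinateFamily 𝒜)
    {D : C^∞⟮J, N; ℝ⟯ → C^∞⟮J, N; ℝ⟯} (hsub : ∀ f g, D (f - g) = D f - D g)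
    (hlocal : ∀ (f : C^∞⟮J, N; ℝ⟯) (x : N), mvfderiv J f x = 0 → D f x = 0) (h : ∀ f ∈ 𝒜, D f = 0)
    (f : C^∞⟮J, N; ℝ⟯) : D f = 0 := by
  ext x
  obtain ⟨g, hg, hfg⟩ := h𝒜.exists_mvfderiv_eq x (mvfderiv J f x)
  have h0 := hlocal (f - g) x (by rw [mvfderiv_smoothMap_sub, hfg, sub_self])
  rwa [hsub, h g hg, sub_zero] at h0

theorem tangent_ext (h𝒜 : IsCoordinateFamily 𝒜) {x : N} {v w : TangentSpace J x}
    (h : ∀ f ∈ 𝒜, mvfderiv J f x v = mvfderiv J f x w) : v = w := by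
  refine (SeparatingDual.eq_iff_forall_dual_eq (R := ℝ) (V := E)).2 fun (α : Cotangent J x) => ?_
  obtain ⟨f, hf, rfl⟩ := h𝒜.exists_mvfderiv_eq x α
  exact h f hf

theorem bivectorField_ext (h𝒜 : IsCoordinateFamily 𝒜) {Λ Λ' : BivectorField J N}
    (h : ∀ f ∈ 𝒜, ∀ g ∈ 𝒜, ∀ x, Λ.onFun f g x = Λ'.onFun f g x) : Λ = Λ' := by
  ext x α β
  obtain ⟨f, hf, rfl⟩ := h𝒜.exists_mvfderiv_eq x α
  obtain ⟨g, hg, rfl⟩ := h𝒜.exists_mvfderiv_eq x β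
  exact h f hf g hg x

variable [FiniteDimensional ℝ E]

theorem contMDiff_vectorField (h𝒜 : IsCoordinateFamily 𝒜) {Y : ∀ x : N, TangentSpace J x}
    (hY : ∀ f ∈ 𝒜, ContMDiff J 𝓘(ℝ, ℝ) ∞ fun x => mvfderiv J f x (Y x)) :
    ContMDiff J (J.prod 𝓘(ℝ, E)) ∞ fun x => TotalSpace.mk' E x (Y x) := by
  intro x₀
  rw [contMDiffAt_vectorField_iff]
  obtain ⟨Ψ, hΨ, hcomp⟩ := h𝒜 x₀
  let b := Module.finBasis ℝ E
  choose u hu huΨ using fun i => hcomp (b.coord i).toContinuousLinearMap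
  have hsum : (fun x => mvfderiv J (extChartAt J x₀) x (Y x)) =ᶠ[𝓝 x₀]
      fun x => ∑ i, mvfderiv J (u i) x (Y x) • b i := by
    filter_upwards [hΨ.eventuallyEq_nhds] with x hx
    simp only [fun i => funext (huΨ i), mvfderiv_clm_comp _ ((Ψ.contMDiff x).mdifferentiableAt
      (by simp)), ← mvfderiv_congr_of_eventuallyEq hx]
    exact (b.sum_repr _).symm
  exact (contMDiffAt_finsetSum fun i _ => (hY _ (hu i) x₀).smul
    contMDiffAt_const).congr_of_eventuallyEq hsum

variable [J.Boundaryless]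

theorem exists_local_coframe (h𝒜 : IsCoordinateFamily 𝒜) (x₀ : N) :
    ∃ (n : ℕ) (u : Fin n → C^∞⟮J, N; ℝ⟯), (∀ i, u i ∈ 𝒜) ∧
      ∀ f : N → ℝ, ContMDiff J 𝓘(ℝ, ℝ) ∞ f → ∃ c : Fin n → N → ℝ,
        (∀ i, ContMDiffAt J 𝓘(ℝ, ℝ) ∞ (c i) x₀) ∧
          ∀ᶠ x in 𝓝 x₀, mvfderiv J f x = ∑ i, c i x • mvfderiv J (u i) x := by
  obtain ⟨Ψ, hΨ, hcomp⟩ := h𝒜 x₀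
  let b := Module.finBasis ℝ E
  choose u hu huΨ using fun i => hcomp (b.coord i).toContinuousLinearMap
  refine ⟨_, u, hu, fun f hf => ⟨fun i x => coordDeriv J x₀ f x (b i), fun i =>
    (contMDiffAt_coordDeriv hf x₀).clm_apply contMDiffAt_const, ?_⟩⟩
  filter_upwards [hΨ.eventuallyEq_nhds, (chartAt H x₀).open_source.mem_nhds
    (mem_chart_source H x₀)] with x hx hxs
  rw [mvfderiv_eq_coordDeriv_comp hf hxs, ← mvfderiv_congr_of_eventuallyEq hx]
  simp only [fun i => funext (huΨ i),
    mvfderiv_clm_comp _ ((Ψ.contMDiff x).mdifferentiableAt (by simp))]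
  ext v
  have hv : mvfderiv J Ψ x v = ∑ i, b.repr (mvfderiv J Ψ x v) i • b i := (b.sum_repr _).symm
  rw [ContinuousLinearMap.comp_apply, hv, map_sum, sum_apply]
  exact Finset.sum_congr rfl fun i _ => by rw [map_smul, smul_eq_mul, mul_comm]; rfl

theorem contMDiff_form (h𝒜 : IsCoordinateFamily 𝒜)
    {B : ∀ x : N, Cotangent J x →ₗ[ℝ] Cotangent J x →ₗ[ℝ] ℝ}
    (hB : ∀ f ∈ 𝒜, ∀ g ∈ 𝒜,
      ContMDiff J 𝓘(ℝ, ℝ) ∞ fun x => B x (mvfderiv J f x) (mvfderiv J g x))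
    {f g : N → ℝ} (hf : ContMDiff J 𝓘(ℝ, ℝ) ∞ f) (hg : ContMDiff J 𝓘(ℝ, ℝ) ∞ g) :
    ContMDiff J 𝓘(ℝ, ℝ) ∞ fun x => B x (mvfderiv J f x) (mvfderiv J g x) := by
  intro x₀
  obtain ⟨n, u, hu, hcoframe⟩ := h𝒜.exists_local_coframe x₀
  obtain ⟨c, hc, hfc⟩ := hcoframe f hf
  obtain ⟨d, hd, hgd⟩ := hcoframe g hg
  have hsmooth : ContMDiffAt J 𝓘(ℝ, ℝ) ∞ (fun x => ∑ j, d j x *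
      ∑ i, c i x * B x (mvfderiv J (u i) x) (mvfderiv J (u j) x)) x₀ :=
    contMDiffAt_finsetSum fun j _ => (hd j).mul <| contMDiffAt_finsetSum fun i _ =>
      (hc i).mul (hB _ (hu i) _ (hu j) x₀)
  refine hsmooth.congr_of_eventuallyEq ?_
  filter_upwards [hfc, hgd] with x hfx hgx
  simp only [hfx, hgx, map_sum, map_smul, LinearMap.sum_apply, LinearMap.smul_apply, smul_eq_mul]

theorem exists_hamiltonian (h𝒜 : IsCoordinateFamily 𝒜) (Λ : BivectorField J N)
    (f : C^∞⟮J, N; ℝ⟯) : ∃ X : VectorField J N, X.derivation = Λ.biderivation f := by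
  have hdual : ∀ x, ∃ v : TangentSpace J x, ∀ α : Cotangent J x,
      α v = Λ.form x (mvfderiv J f x) α := fun x => exists_eval_eq (G := E) _
  choose Y hY using hdual
  have hact : ∀ (g : N → ℝ) (x : N), mvfderiv J g x (Y x) = Λ.onFun f g x := fun g x =>
    hY x (mvfderiv J g x)
  refine ⟨⟨Y, h𝒜.contMDiff_vectorField fun g _ => ?_⟩, ?_⟩
  · simp only [hact]
    exact Λ.smooth f g f.contMDiff g.contMDiff
  · ext g x
    exact hact g x

theorem exists_bivectorField {P : Type*} [AddCommGroup P] [Module ℝ P]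
    {Φ : P →ₗ[ℝ] C^∞⟮J, N; ℝ⟯} (hΦ : IsCoordinateFamily (Set.range Φ))
    {B : N → P →ₗ[ℝ] P →ₗ[ℝ] ℝ} (halt : ∀ x p, B x p p = 0)
    (hker : ∀ x p q, mvfderiv J (Φ q) x = 0 → B x p q = 0)
    (hsmooth : ∀ p q, ContMDiff J 𝓘(ℝ, ℝ) ∞ fun x => B x p q) :
    ∃ Λ : BivectorField J N, ∀ p q x, Λ.onFun (Φ p) (Φ q) x = B x p q := by
  have hform : ∀ x, ∃ C : Cotangent J x →ₗ[ℝ] Cotangent J x →ₗ[ℝ] ℝ, (∀ α, C α α = 0) ∧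
      ∀ p q, C (mvfderiv J (Φ p) x) (mvfderiv J (Φ q) x) = B x p q := fun x =>
    exists_form_comp_eq (d := (differentialAt J x).comp Φ) (fun α => by
      obtain ⟨_, ⟨p, rfl⟩, hp⟩ := hΦ.exists_mvfderiv_eq x α
      exact ⟨p, hp⟩) (halt x) (hker x)
  choose C hCalt hC using hform
  refine ⟨⟨C, hCalt, fun f g hf hg => hΦ.contMDiff_form ?_ hf hg⟩, fun p q x => hC x p q⟩
  rintro _ ⟨p, rfl⟩ _ ⟨q, rfl⟩
  simpa only [hC] using hsmooth p q

variable (h𝒜 : IsCoordinateFamily 𝒜) (Λ : BivectorField J N) (X : VectorField J N)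
include h𝒜

theorem selfDefect_apply_eq_zero (f g : C^∞⟮J, N; ℝ⟯) {h : C^∞⟮J, N; ℝ⟯} {x : N}
    (h0 : mvfderiv J h x = 0) : selfDefect Λ.biderivation X.derivation f g h x = 0 := by
  obtain ⟨Xf, hXf⟩ := h𝒜.exists_hamiltonian Λ f
  obtain ⟨Xg, hXg⟩ := h𝒜.exists_hamiltonian Λ g
  have hcomm : Λ.biderivation f (Λ.biderivation g h) x =
      Λ.biderivation g (Λ.biderivation f h) x := by
    rw [← hXf, ← hXg]
    exact act_act_comm_of_mvfderiv_eq_zero Xf Xg h.contMDiff h0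
  have hΛ : ∀ k, Λ.biderivation k h x = 0 := fun k =>
    (congrArg (Λ.form x _) h0).trans (map_zero _)
  have hX : X.derivation h x = 0 := DFunLike.congr_fun h0 (X x)
  unfold selfDefect
  rw [Λ.biderivation_skew h f, Λ.biderivation_skew (Λ.biderivation g h), map_neg,
    Derivation.neg_apply, Λ.biderivation_skew (Λ.biderivation f h)]
  change Λ.biderivation (Λ.biderivation f g) h x + -(Λ.biderivation f (Λ.biderivation g h) x)
    + - -(Λ.biderivation g (Λ.biderivation f h) x) - (X.derivation f x * Λ.biderivation g h x
    + X.derivation g x * -(Λ.biderivation f h x)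
    + X.derivation h x * Λ.biderivation f g x) = 0
  rw [hcomm, hΛ, hΛ, hΛ, hX]
  ring

theorem mixedDefect_apply_eq_zero (f : C^∞⟮J, N; ℝ⟯) {g : C^∞⟮J, N; ℝ⟯} {x : N}
    (h0 : mvfderiv J g x = 0) : mixedDefect Λ.biderivation X.derivation f g x = 0 := by
  obtain ⟨Xf, hXf⟩ := h𝒜.exists_hamiltonian Λ f
  have hcomm : X.derivation (Λ.biderivation f g) x = Λ.biderivation f (X.derivation g) x := by
    rw [← hXf]
    exact act_act_comm_of_mvfderiv_eq_zero X Xf g.contMDiff h0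
  have hΛ : Λ.biderivation (X.derivation f) g x = 0 :=
    (congrArg (Λ.form x _) h0).trans (map_zero _)
  change X.derivation (Λ.biderivation f g) x - Λ.biderivation (X.derivation f) g x
    - Λ.biderivation f (X.derivation g) x = 0
  rw [hcomm, hΛ]
  ring

variable {Λ X}

theorem mixedDefect_eq_zero (h : ∀ f ∈ 𝒜, ∀ g ∈ 𝒜, mixedDefect Λ.biderivation X.derivation f g = 0)
    (f g : C^∞⟮J, N; ℝ⟯) : mixedDefect Λ.biderivation X.derivation f g = 0 := by
  have hright : ∀ f ∈ 𝒜, ∀ g, mixedDefect Λ.biderivation X.derivation f g = 0 := fun f hf =>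
    h𝒜.eq_zero_of_forall_mem (mixedDefect_sub_right f)
      (fun _ _ => h𝒜.mixedDefect_apply_eq_zero Λ X f) (h f hf)
  refine h𝒜.eq_zero_of_forall_mem (mixedDefect_sub_right f)
    (fun _ _ => h𝒜.mixedDefect_apply_eq_zero Λ X f) (fun g hg => ?_) g
  rw [mixedDefect_skew Λ.biderivation_skew, hright g hg, neg_zero]

theorem selfDefect_eq_zero
    (h : ∀ f ∈ 𝒜, ∀ g ∈ 𝒜, ∀ k ∈ 𝒜, selfDefect Λ.biderivation X.derivation f g k = 0)
    (f g k : C^∞⟮J, N; ℝ⟯) : selfDefect Λ.biderivation X.derivation f g k = 0 := by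
  have hthird : ∀ f g, (∀ k ∈ 𝒜, selfDefect Λ.biderivation X.derivation f g k = 0) →
      ∀ k, selfDefect Λ.biderivation X.derivation f g k = 0 := fun f g =>
    h𝒜.eq_zero_of_forall_mem (selfDefect_sub_right f g)
      fun _ _ => h𝒜.selfDefect_apply_eq_zero Λ X f g
  refine hthird f g (fun k hk => ?_) k
  rw [selfDefect_rotate]
  refine hthird k f (fun g hg => ?_) g
  rw [selfDefect_rotate]
  exact hthird g k (fun f hf => h g hg k hk f hf) f

/-- The Jacobi structure `(Λ, X)` obtained when the bracket `Λ(f, g) + f X(g) - g X(f)` satisfies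
the Jacobi identity on a coordinate family containing the constant `1`. -/
def jacobiStructure (hone : 1 ∈ 𝒜) (hjacobi : ∀ f ∈ 𝒜, ∀ g ∈ 𝒜, ∀ k ∈ 𝒜,
      jacobiator (derivationBracket Λ.biderivation X.derivation) f g k = 0) : JacobiStructure J N :=
  have hmixed : ∀ f g, mixedDefect Λ.biderivation X.derivation f g = 0 :=
    h𝒜.mixedDefect_eq_zero fun f hf g hg =>
      mixedDefect_eq_zero_of_jacobiator Λ.biderivation_skew (hjacobi f hf g hg 1 hone)
  have hself : ∀ f g k, selfDefect Λ.biderivation X.derivation f g k = 0 :=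
    h𝒜.selfDefect_eq_zero fun f hf g hg k hk => by
    simpa only [jacobiator_derivationBracket Λ.biderivation_skew, hmixed, mul_zero, add_zero,
      sub_zero] using hjacobi f hf g hg k hk
  { Λ := Λ
    E := X
    schouten_self f g k hf hg hk x := by
      have h := DFunLike.congr_fun (hself ⟨f, hf⟩ ⟨g, hg⟩ ⟨k, hk⟩) x
      exact congrArg (-2 * ·) (sub_eq_zero.1 h)
    schouten_mixed f g hf hg x := DFunLike.congr_fun (hmixed ⟨f, hf⟩ ⟨g, hg⟩) x }

end Pointwise

end IsCoordinateFamily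

section JacobiIdentity

variable [IsManifold J ∞ N] [J.Boundaryless]

theorem JacobiStructure.jacobiator_eq_zero (S : JacobiStructure J N) (f g h : C^∞⟮J, N; ℝ⟯) :
    jacobiator (derivationBracket S.Λ.biderivation S.E.derivation) f g h = 0 := by
  have hself : selfDefect S.Λ.biderivation S.E.derivation f g h = 0 := ContMDiffMap.ext fun x =>
    sub_eq_zero.2 (mul_left_cancel₀ (by norm_num)
      (S.schouten_self f g h f.contMDiff g.contMDiff h.contMDiff x))
  have hmixed : ∀ f g, mixedDefect S.Λ.biderivation S.E.derivation f g = 0 := fun f g =>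
    ContMDiffMap.ext (S.schouten_mixed f g f.contMDiff g.contMDiff)
  simp only [jacobiator_derivationBracket S.Λ.biderivation_skew, hself, hmixed, mul_zero, add_zero,
    sub_zero]

end JacobiIdentity

end CoordinateFamily

/-! ### Sections of vector bundles -/

section Hom

theorem contMDiffAt_clm_of_apply {E : Type*} [NormedAddCommGroup E] [NormedSpace ℝ E]
    {H : Type*} [TopologicalSpace H] {J : ModelWithCorners ℝ E H}
    {N : Type*} [TopologicalSpace N] [ChartedSpace H N]
    {G G' : Type*} [NormedAddCommGroup G] [NormedSpace ℝ G] [FiniteDimensional ℝ G]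
    [NormedAddCommGroup G'] [NormedSpace ℝ G'] {L : N → G →L[ℝ] G'} {x : N}
    (h : ∀ w, ContMDiffAt J 𝓘(ℝ, G') ∞ (fun y => L y w) x) :
    ContMDiffAt J 𝓘(ℝ, G →L[ℝ] G') ∞ L x := by
  let b := Module.finBasis ℝ G
  have hL : L = fun y => ∑ i, ContinuousLinearMap.smulRightL ℝ G G'
      ((b.coord i).toContinuousLinearMap) (L y (b i)) := by
    funext y
    ext w
    conv_lhs => rw [← b.sum_repr w, map_sum]
    simp
  rw [hL]
  exact contMDiffAt_finsetSum fun i _ =>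
    (ContinuousLinearMap.contMDiff _).contMDiffAt.comp x (h (b i))

variable {E : Type*} [NormedAddCommGroup E] [NormedSpace ℝ E]
  {H : Type*} [TopologicalSpace H] {I : ModelWithCorners ℝ E H}
  {M : Type*} [TopologicalSpace M] [ChartedSpace H M]
  {G : Type*} [NormedAddCommGroup G] [NormedSpace ℝ G] [FiniteDimensional ℝ G]
  {W : M → Type*} [TopologicalSpace (TotalSpace G W)]
  [∀ x, AddCommGroup (W x)] [∀ x, Module ℝ (W x)] [∀ x, TopologicalSpace (W x)]
  [FiberBundle G W] [VectorBundle ℝ G W]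
  {G' : Type*} [NormedAddCommGroup G'] [NormedSpace ℝ G']
  {W' : M → Type*} [TopologicalSpace (TotalSpace G' W')]
  [∀ x, AddCommGroup (W' x)] [∀ x, Module ℝ (W' x)] [∀ x, TopologicalSpace (W' x)]
  [FiberBundle G' W'] [VectorBundle ℝ G' W']
  [∀ x, IsTopologicalAddGroup (W' x)] [∀ x, ContinuousSMul ℝ (W' x)]

theorem contMDiffAt_hom_of_apply_symm {φ : ∀ x, W x →L[ℝ] W' x} {x₀ : M}
    (h : ∀ w : G, ContMDiffAt I (I.prod 𝓘(ℝ, G')) ∞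
      (fun x => TotalSpace.mk' G' x (φ x ((trivializationAt G W x₀).symm x w))) x₀) :
    ContMDiffAt I (I.prod 𝓘(ℝ, G →L[ℝ] G')) ∞
      (fun x => TotalSpace.mk' (G →L[ℝ] G') (E := fun x => W x →L[ℝ] W' x) x (φ x)) x₀ := by
  rw [contMDiffAt_hom_bundle]
  refine ⟨contMDiffAt_id, contMDiffAt_clm_of_apply fun w => ?_⟩
  refine ((contMDiffAt_section x₀).1 (h w)).congr_of_eventuallyEq ?_
  filter_upwards [(trivializationAt G W x₀).open_baseSet.mem_nhds
    (FiberBundle.mem_baseSet_trivializationAt' x₀),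
    (trivializationAt G' W' x₀).open_baseSet.mem_nhds
    (FiberBundle.mem_baseSet_trivializationAt' x₀)] with x hx hx'
  simp only [ContinuousLinearMap.inCoordinates, ContinuousLinearMap.comp_apply]
  rw [Trivialization.continuousLinearMapAt_apply, Trivialization.linearMapAt_apply,
    if_pos hx', Trivialization.symmL_apply _ hx]

end Hom

section Cutoff

variable {E : Type*} [NormedAddCommGroup E] [NormedSpace ℝ E] [FiniteDimensional ℝ E]
  {H : Type*} [TopologicalSpace H] {I : ModelWithCorners ℝ E H}
  {M : Type*} [TopologicalSpace M] [T2Space M] [ChartedSpace H M] [IsManifold I ∞ M]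

variable (I) in
theorem exists_cutoff {x₀ : M} {U : Set M} (hU : U ∈ 𝓝 x₀) :
    ∃ χ : C^∞⟮I, M; ℝ⟯, tsupport χ ⊆ U ∧ χ =ᶠ[𝓝 x₀] 1 := by
  obtain ⟨χ, -, hχ⟩ := (SmoothBumpFunction.nhds_basis_tsupport (I := I) x₀).mem_iff.1 hU
  exact ⟨⟨χ, χ.contMDiff⟩, hχ, χ.eventuallyEq_one⟩

theorem isCoordinateFamily_univ : IsCoordinateFamily (Set.univ : Set C^∞⟮I, M; ℝ⟯) := by
  intro x₀
  obtain ⟨χ⟩ : Nonempty (SmoothBumpFunction I x₀) := inferInstance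
  let Ψ : C^∞⟮I, M; 𝓘(ℝ, E), E⟯ := ⟨_, χ.contMDiff_smul (contMDiffOn_extChartAt (n := ∞))⟩
  refine ⟨Ψ, ?_, fun c => ⟨⟨_, c.contMDiff.comp Ψ.contMDiff⟩, Set.mem_univ _, fun _ => rfl⟩⟩
  filter_upwards [χ.eventuallyEq_one] with y hy
  exact (congrArg (· • extChartAt I x₀ y) hy).trans (one_smul _ _)

end Cutoff

section Sections

variable {E : Type*} [NormedAddCommGroup E] [NormedSpace ℝ E]
  {H : Type*} [TopologicalSpace H] {I : ModelWithCorners ℝ E H}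
  {M : Type*} [TopologicalSpace M] [ChartedSpace H M]
  {G : Type*} [NormedAddCommGroup G] [NormedSpace ℝ G]
  {W : M → Type*} [TopologicalSpace (TotalSpace G W)]
  [∀ x, AddCommGroup (W x)] [∀ x, Module ℝ (W x)] [∀ x, TopologicalSpace (W x)]
  [FiberBundle G W] [VectorBundle ℝ G W]

theorem sum_smulSection_apply {ι : Type*} [Fintype ι] (f : ι → C^∞⟮I, M; ℝ⟯)
    (s : ι → Cₛ^∞⟮I; G, W⟯) (x : M) :
    (∑ i, smulSection (f i) (s i)) x = ∑ i, f i x • s i x :=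
  (congrFun (map_sum (ContMDiffSection.coeAddHom I G ∞ W) _ _) x).trans (Finset.sum_apply _ _ _)

theorem contMDiff_pairing (X : Cₛ^∞⟮I; G, W⟯) (a : DualSection I G W) :
    ContMDiff I 𝓘(ℝ, ℝ) ∞ (pairing X a) := fun x =>
  (contMDiffAt_section x).1 ((a.contMDiff x).clm_bundle_apply (F₂ := ℝ) (E₂ := Bundle.Trivial M ℝ)
    (X.contMDiff x))

/-- The pairing `a ↦ ⟨a, X⟩` with a section `X`, as a linear map into smooth functions. -/
def pairingHom (X : Cₛ^∞⟮I; G, W⟯) : DualSection I G W →ₗ[ℝ] C^∞⟮I, M; ℝ⟯ where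
  toFun a := ⟨pairing X a, contMDiff_pairing X a⟩
  map_add' _ _ := rfl
  map_smul' _ _ := rfl

variable [T2Space M] [FiniteDimensional ℝ E] [IsManifold I ∞ M] [ContMDiffVectorBundle ∞ G W I]

theorem exists_section_eventuallyEq_symm (x₀ : M) (w : G) :
    ∃ s : Cₛ^∞⟮I; G, W⟯, ∀ᶠ x in 𝓝 x₀, s x = (trivializationAt G W x₀).symm x w := by
  have hbase := (trivializationAt G W x₀).open_baseSet
  obtain ⟨χ, hχ, h1⟩ := exists_cutoff I (hbase.mem_nhds
    (FiberBundle.mem_baseSet_trivializationAt' x₀))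
  have hsymm : ContMDiffOn I (I.prod 𝓘(ℝ, G)) ∞
      (fun x => TotalSpace.mk' G x ((trivializationAt G W x₀).symm x w))
      (trivializationAt G W x₀).baseSet := by
    rw [Trivialization.contMDiffOn_section_baseSet_iff]
    exact (contMDiffOn_const (c := w)).congr fun x hx =>
      congrArg Prod.snd ((trivializationAt G W x₀).apply_mk_symm hx w)
  refine ⟨⟨_, χ.contMDiff.contMDiffOn.smul_section_of_tsupport hbase hχ hsymm⟩, ?_⟩
  filter_upwards [h1] with x hx
  exact (congrArg (· • (trivializationAt G W x₀).symm x w) hx).trans (one_smul _ _)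

section HomSections

variable [FiniteDimensional ℝ G]
  {G' : Type*} [NormedAddCommGroup G'] [NormedSpace ℝ G']
  {W' : M → Type*} [TopologicalSpace (TotalSpace G' W')]
  [∀ x, AddCommGroup (W' x)] [∀ x, Module ℝ (W' x)] [∀ x, TopologicalSpace (W' x)]
  [FiberBundle G' W'] [VectorBundle ℝ G' W']
  [∀ x, IsTopologicalAddGroup (W' x)] [∀ x, ContinuousSMul ℝ (W' x)]

theorem contMDiff_hom_of_apply_section {φ : ∀ x, W x →L[ℝ] W' x}
    (h : ∀ s : Cₛ^∞⟮I; G, W⟯, ContMDiff I (I.prod 𝓘(ℝ, G')) ∞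
      fun x => TotalSpace.mk' G' x (φ x (s x))) :
    ContMDiff I (I.prod 𝓘(ℝ, G →L[ℝ] G')) ∞
      fun x => TotalSpace.mk' (G →L[ℝ] G') (E := fun x => W x →L[ℝ] W' x) x (φ x) := fun x₀ =>
  contMDiffAt_hom_of_apply_symm fun w => by
    obtain ⟨s, hs⟩ := exists_section_eventuallyEq_symm (I := I) (W := W) x₀ w
    refine (h s x₀).congr_of_eventuallyEq ?_
    filter_upwards [hs] with x hx
    rw [hx]

end HomSections

variable [FiniteDimensional ℝ G]

theorem contMDiff_dualSection {a : ∀ x, DualFiber W x}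
    (h : ∀ X : Cₛ^∞⟮I; G, W⟯, ContMDiff I 𝓘(ℝ, ℝ) ∞ fun x => (a x (X x) : ℝ)) :
    ContMDiff I (I.prod 𝓘(ℝ, G →L[ℝ] ℝ)) ∞
      fun x => TotalSpace.mk' (G →L[ℝ] ℝ) (E := DualFiber W) x (a x) :=
  contMDiff_hom_of_apply_section (W' := Bundle.Trivial M ℝ) fun X x =>
    (contMDiffAt_section x).2 (h X x)

theorem exists_dualSection_eventuallyEq (x₀ : M) (c : G →L[ℝ] ℝ) : ∃ a : DualSection I G W,
    ∀ᶠ x in 𝓝 x₀, ∀ w : W x, a x w = c (trivializationAt G W x₀ ⟨x, w⟩).2 := by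
  let e := trivializationAt G W x₀
  have hbase := e.open_baseSet.mem_nhds (FiberBundle.mem_baseSet_trivializationAt' x₀)
  obtain ⟨χ, hχ, h1⟩ := exists_cutoff I hbase
  let a : ∀ x, DualFiber W x := fun x => (χ x • c).comp (e.continuousLinearMapAt ℝ x)
  have happly : ∀ {x} (_ : x ∈ e.baseSet) (w : W x), a x w = χ x * c (e ⟨x, w⟩).2 :=
    fun {x} hx w => congrArg (χ x * c ·) (congrFun (e.coe_linearMapAt_of_mem hx) w)
  have ha : ∀ X : Cₛ^∞⟮I; G, W⟯, ContMDiff I 𝓘(ℝ, ℝ) ∞ fun x => (a x (X x) : ℝ) := by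
    refine fun X => contMDiff_of_tsupport fun x hx => ?_
    have hxe : x ∈ e.baseSet := hχ (tsupport_mul_subset_left hx)
    refine ((χ.contMDiff x).smul (c.contMDiff.contMDiffAt.comp x
        ((e.contMDiffAt_section_iff hxe).1 (X.contMDiff x)))).congr_of_eventuallyEq ?_
    filter_upwards [e.open_baseSet.mem_nhds hxe] with y hy using happly hy (X y)
  refine ⟨⟨a, contMDiff_dualSection ha⟩, ?_⟩
  filter_upwards [hbase, h1] with x hx hx1 w
  exact (happly hx w).trans (by rw [hx1, Pi.one_apply, one_mul])

variable (I G W) in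
theorem exists_dual_frame (x₀ : M) : ∃ (n : ℕ) (s : Fin n → Cₛ^∞⟮I; G, W⟯)
    (c : Fin n → DualSection I G W), ∀ᶠ x in 𝓝 x₀, ∀ w : W x, w = ∑ i, (c i x w : ℝ) • s i x := by
  let e := trivializationAt G W x₀
  let b := Module.finBasis ℝ G
  choose s hs using fun i => exists_section_eventuallyEq_symm (I := I) (W := W) x₀ (b i)
  choose c hc using fun i => exists_dualSection_eventuallyEq (I := I) (W := W) x₀
    (b.coord i).toContinuousLinearMap
  refine ⟨_, s, c, ?_⟩
  filter_upwards [e.open_baseSet.mem_nhds (FiberBundle.mem_baseSet_trivializationAt' x₀),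
    eventually_all.2 hs, eventually_all.2 hc] with x hx hsx hcx w
  calc w = e.symmL ℝ x (e ⟨x, w⟩).2 :=
        ((e.symmL_apply hx _).trans (e.symm_proj_apply ⟨x, w⟩ hx)).symm
    _ = ∑ i, b.coord i (e ⟨x, w⟩).2 • e.symmL ℝ x (b i) := by
        conv_lhs => rw [← b.sum_repr (e ⟨x, w⟩).2, map_sum]
        exact Finset.sum_congr rfl fun i _ => map_smul _ _ _
    _ = ∑ i, (c i x w : ℝ) • s i x := Finset.sum_congr rfl fun i _ => by
        rw [hsx, hcx, e.symmL_apply hx]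
        rfl

variable (I G) in
theorem exists_section_apply_eq {x : M} (w : W x) : ∃ s : Cₛ^∞⟮I; G, W⟯, s x = w := by
  obtain ⟨n, s, c, h⟩ := exists_dual_frame I G W x
  refine ⟨∑ i, smulSection (ContMDiffMap.const (c i x w : ℝ)) (s i), ?_⟩
  rw [sum_smulSection_apply]
  exact (h.self_of_nhds w).symm

theorem eq_of_forall_dualSection {x : M} {w w' : W x}
    (h : ∀ a : DualSection I G W, a x w = a x w') : w = w' := by
  obtain ⟨n, s, c, hframe⟩ := exists_dual_frame I G W x
  rw [hframe.self_of_nhds w, hframe.self_of_nhds w']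
  simp only [h]

theorem contMDiff_of_contMDiff_dualSection {X : ∀ x, W x}
    (h : ∀ a : DualSection I G W, ContMDiff I 𝓘(ℝ, ℝ) ∞ fun x => (a x (X x) : ℝ)) :
    ContMDiff I (I.prod 𝓘(ℝ, G)) ∞ fun x => TotalSpace.mk' G x (X x) := by
  intro x₀
  obtain ⟨n, s, c, hframe⟩ := exists_dual_frame I G W x₀
  have hsum : ContMDiffAt I (I.prod 𝓘(ℝ, G)) ∞
      (fun x => TotalSpace.mk' G x (∑ i, (c i x (X x) : ℝ) • s i x)) x₀ :=
    ContMDiffAt.sum_section fun i _ => (h (c i) x₀).smul_section ((s i).contMDiff x₀)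
  refine hsum.congr_of_eventuallyEq ?_
  filter_upwards [hframe] with x hx
  exact congrArg (TotalSpace.mk' G x) (hx (X x))

section Tensorial

variable {A : Type*} [AddCommGroup A] [Module ℝ A] {x : M} (T : Cₛ^∞⟮I; G, W⟯ →+ A)
  (hT : ∀ (f : C^∞⟮I, M; ℝ⟯) s, T (smulSection f s) = f x • T s)
include hT

theorem map_eq_zero_of_apply_eq_zero {s : Cₛ^∞⟮I; G, W⟯} (hs : s x = 0) : T s = 0 := by
  obtain ⟨n, t, c, hframe⟩ := exists_dual_frame I G W x
  obtain ⟨χ, hχ, h1⟩ := exists_cutoff I hframe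
  have hdecomp : smulSection χ s = ∑ i, smulSection (χ * pairingHom s (c i)) (t i) := by
    ext y
    rw [sum_smulSection_apply]
    change χ y • s y = ∑ i, (χ y * (c i y (s y) : ℝ)) • t i y
    by_cases hy : y ∈ tsupport χ
    · conv_lhs => rw [hχ hy (s y), Finset.smul_sum]
      simp only [mul_smul]
    · simp only [image_eq_zero_of_notMem_tsupport hy, zero_smul, zero_mul, Finset.sum_const_zero]
  have hpair : ∀ i, pairingHom s (c i) x = 0 := fun i =>
    (congrArg (c i x) hs).trans (map_zero _)
  calc T s = T (smulSection χ s) := by rw [hT, h1.self_of_nhds, Pi.one_apply, one_smul]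
    _ = ∑ i, (χ * pairingHom s (c i)) x • T (t i) := by simp only [hdecomp, map_sum, hT]
    _ = 0 := Finset.sum_eq_zero fun i _ => by
        rw [ContMDiffMap.coe_mul, Pi.mul_apply, hpair, mul_zero, zero_smul]

theorem exists_linearMap_of_tensorial : ∃ φ : W x →ₗ[ℝ] A, ∀ s, φ (s x) = T s := by
  choose σ hσ using fun w : W x => exists_section_apply_eq I G w
  have hT0 : ∀ {s t : Cₛ^∞⟮I; G, W⟯}, s x = t x → T s = T t := fun {s t} h => by
    rw [← sub_eq_zero, ← map_sub]
    exact map_eq_zero_of_apply_eq_zero T hT (sub_eq_zero.2 h)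
  refine ⟨{ toFun := fun w => T (σ w), map_add' := fun w w' => ?_, map_smul' := fun r w => ?_ },
    fun s => hT0 (hσ (s x))⟩
  · rw [← map_add]
    exact hT0 ((hσ _).trans (congrArg₂ (· + ·) (hσ w) (hσ w')).symm)
  · exact (hT0 (t := smulSection (ContMDiffMap.const r) (σ w))
      ((hσ _).trans (congrArg (r • ·) (hσ w)).symm)).trans (hT _ _)

end Tensorial

variable (G) in
theorem exists_vector_of_tensorial {x : M} [IsTopologicalAddGroup (W x)] [ContinuousSMul ℝ (W x)]
    (T : DualSection I G W →+ ℝ)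
    (hT : ∀ (f : C^∞⟮I, M; ℝ⟯) a, T (smulSection f a) = f x * T a) :
    ∃ w : W x, ∀ a : DualSection I G W, a x w = T a := by
  obtain ⟨φ, hφ⟩ := exists_linearMap_of_tensorial T hT
  have := FiberBundle.t2Space G W x
  have := VectorBundle.finiteDimensional ℝ G W x
  obtain ⟨w, hw⟩ := exists_eval_eq φ
  exact ⟨w, fun a => (hw (a x)).trans (hφ a)⟩

theorem exists_section_of_tensorial [∀ x, IsTopologicalAddGroup (W x)]
    [∀ x, ContinuousSMul ℝ (W x)] (T : DualSection I G W →ₗ[ℝ] C^∞⟮I, M; ℝ⟯)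
    (hT : ∀ f a, T (smulSection f a) = f * T a) : ∃ X : Cₛ^∞⟮I; G, W⟯, pairingHom X = T := by
  choose X hX using fun x => exists_vector_of_tensorial G
    ((ContMDiffMap.evalRingHom x).toAddMonoidHom.comp T.toAddMonoidHom)
    (fun f a => DFunLike.congr_fun (hT f a) x)
  refine ⟨⟨X, contMDiff_of_contMDiff_dualSection fun a => ?_⟩, ?_⟩
  · exact (T a).contMDiff.congr fun x => hX x a
  · ext a x
    exact hX x a

theorem exists_hom_of_tensorial
    {G' : Type*} [NormedAddCommGroup G'] [NormedSpace ℝ G']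
    {W' : M → Type*} [TopologicalSpace (TotalSpace G' W')]
    [∀ x, AddCommGroup (W' x)] [∀ x, Module ℝ (W' x)] [∀ x, TopologicalSpace (W' x)]
    [FiberBundle G' W'] [VectorBundle ℝ G' W']
    [∀ x, IsTopologicalAddGroup (W' x)] [∀ x, ContinuousSMul ℝ (W' x)]
    [∀ x, IsTopologicalAddGroup (W x)] [∀ x, ContinuousSMul ℝ (W x)]
    (T : Cₛ^∞⟮I; G, W⟯ →+ Cₛ^∞⟮I; G', W'⟯)
    (hT : ∀ f s, T (smulSection f s) = smulSection f (T s)) :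
    ∃ φ : Cₛ^∞⟮I; G →L[ℝ] G', fun x => W x →L[ℝ] W' x⟯, ∀ s x, φ x (s x) = T s x := by
  choose φ hφ using fun x => exists_linearMap_of_tensorial
    (((Pi.evalAddMonoidHom W' x).comp (ContMDiffSection.coeAddHom I G' ∞ W')).comp T)
    (fun f s => DFunLike.congr_fun (hT f s) x)
  have := fun x => FiberBundle.t2Space G W x
  have := fun x => VectorBundle.finiteDimensional ℝ G W x
  refine ⟨⟨fun x => (φ x).toContinuousLinearMap, contMDiff_hom_of_apply_section fun s => ?_⟩,
    fun s x => hφ x s⟩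
  exact (T s).contMDiff.congr fun x => congrArg (TotalSpace.mk' G' x) (hφ x s)

end Sections

/-! ### Affine functions on a vector bundle -/

section AffineFunctions

variable {E : Type*} [NormedAddCommGroup E] [NormedSpace ℝ E]
  {M : Type*} [TopologicalSpace M] [ChartedSpace E M]
  {F : Type*} [NormedAddCommGroup F] [NormedSpace ℝ F]
  {V : M → Type*} [TopologicalSpace (TotalSpace F V)]
  [∀ x, AddCommGroup (V x)] [∀ x, Module ℝ (V x)] [∀ x, TopologicalSpace (V x)]
  [FiberBundle F V] [VectorBundle ℝ F V]

theorem contMDiff_linFun (a : DualSection 𝓘(ℝ, E) F V) :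
    ContMDiff (𝓘(ℝ, E).prod 𝓘(ℝ, F)) 𝓘(ℝ, ℝ) ∞ (linFun a) := by
  intro v
  have h := ContMDiffAt.clm_apply_of_inCoordinates (n := ∞) (IM := 𝓘(ℝ, E).prod 𝓘(ℝ, F))
    (IB₁ := 𝓘(ℝ, E)) (IB₂ := 𝓘(ℝ, E)) (E₁ := V) (E₂ := Bundle.Trivial M ℝ) (m₀ := v)
    (b₁ := TotalSpace.proj) (b₂ := TotalSpace.proj) (ϕ := fun u => a u.proj) (v := fun u => u.snd)
    (((contMDiffAt_hom_bundle _).1 (a.contMDiff v.proj)).2.comp v (contMDiffAt_proj V))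
    contMDiffAt_id (contMDiffAt_proj V)
  exact (contMDiffAt_totalSpace.1 h).2

theorem isLinearFun_linFun (a : DualSection 𝓘(ℝ, E) F V) : IsLinearFun 𝓘(ℝ, E) (linFun a) :=
  ⟨contMDiff_linFun a, fun x => ⟨(a x : V x →L[ℝ] ℝ).toLinearMap, fun _ => rfl⟩⟩

theorem linFun_injective : Function.Injective
    (linFun : DualSection 𝓘(ℝ, E) F V → TotalSpace F V → ℝ) := by
  intro a b h
  ext x w
  exact congrFun h ⟨x, w⟩

/-- The pullback `f ↦ f ∘ π` of smooth functions to the total space. -/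
def basicFun : C^∞⟮𝓘(ℝ, E), M; ℝ⟯ →ₐ[ℝ] C^∞⟮𝓘(ℝ, E).prod 𝓘(ℝ, F), TotalSpace F V; ℝ⟯ where
  toFun f := f.comp ⟨_, contMDiff_proj V⟩
  map_one' := rfl
  map_mul' _ _ := rfl
  map_zero' := rfl
  map_add' _ _ := rfl
  commutes' _ := rfl

variable (E F V) in
/-- Sections of the affine dual `A^* ⊕ (M × ℝ)` of the vector bundle `A`. -/
abbrev AffineDualSection : Type _ :=
  DualSection 𝓘(ℝ, E) F V × C^∞⟮𝓘(ℝ, E), M; ℝ⟯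

/-- The fibrewise affine function `ι_a + f ∘ π` given by a pair `(a, f)`. -/
def affFun : AffineDualSection E F V →ₗ[ℝ]
    C^∞⟮𝓘(ℝ, E).prod 𝓘(ℝ, F), TotalSpace F V; ℝ⟯ where
  toFun p := ⟨linFun p.1, contMDiff_linFun p.1⟩ + basicFun p.2
  map_add' _ _ := ContMDiffMap.ext fun _ => add_add_add_comm _ _ _ _
  map_smul' r p := ContMDiffMap.ext fun v =>
    (mul_add r (p.1 v.proj v.snd : ℝ) (p.2 v.proj)).symm

theorem affFun_apply (p : AffineDualSection E F V) (v : TotalSpace F V) :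
    affFun p v = linFun p.1 v + p.2 v.proj :=
  rfl

theorem affFun_smulSection (f : C^∞⟮𝓘(ℝ, E), M; ℝ⟯) (p : AffineDualSection E F V) :
    affFun (smulSection f p.1, f * p.2) = basicFun f * affFun p :=
  ContMDiffMap.ext fun v => (mul_add (f v.proj) (linFun p.1 v) (p.2 v.proj)).symm

theorem affFun_injective : Function.Injective
    (affFun : AffineDualSection E F V →ₗ[ℝ] _) := by
  intro p q h
  have hsnd : ∀ x, p.2 x = q.2 x := fun x => by
    have h0 := DFunLike.congr_fun h (⟨x, 0⟩ : TotalSpace F V)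
    rw [affFun_apply, affFun_apply] at h0
    simpa [linFun] using h0
  refine Prod.ext (linFun_injective (funext fun v => ?_)) (ContMDiffMap.ext hsnd)
  have hv := DFunLike.congr_fun h v
  rwa [affFun_apply, affFun_apply, hsnd, add_left_inj] at hv

theorem isAffineFun_affFun (p : AffineDualSection E F V) :
    IsAffineFun 𝓘(ℝ, E) (affFun p : TotalSpace F V → ℝ) :=
  ⟨(affFun p).contMDiff, fun x => ⟨(p.1 x : V x →L[ℝ] ℝ).toLinearMap, p.2 x, fun _ => rfl⟩⟩

variable [FiniteDimensional ℝ E] [T2Space M] [IsManifold 𝓘(ℝ, E) ∞ M] [FiniteDimensional ℝ F]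
  [ContMDiffVectorBundle ∞ F V 𝓘(ℝ, E)]

theorem IsLinearFun.exists_linFun_eq [∀ x, IsTopologicalAddGroup (V x)]
    [∀ x, ContinuousSMul ℝ (V x)] {f : TotalSpace F V → ℝ} (hf : IsLinearFun 𝓘(ℝ, E) f) :
    ∃ a : DualSection 𝓘(ℝ, E) F V, linFun a = f := by
  choose φ hφ using hf.2
  have := fun x => FiberBundle.t2Space F V x
  have := fun x => VectorBundle.finiteDimensional ℝ F V x
  let a : ∀ x, DualFiber V x := fun x => (φ x).toContinuousLinearMap
  have ha : ∀ X : Cₛ^∞⟮𝓘(ℝ, E); F, V⟯, ContMDiff 𝓘(ℝ, E) 𝓘(ℝ, ℝ) ∞ fun x => (a x (X x) : ℝ) :=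
    fun X => (hf.1.comp X.contMDiff).congr fun x => (hφ x (X x)).symm
  exact ⟨⟨a, contMDiff_dualSection ha⟩, funext fun v => (hφ v.proj v.snd).symm⟩

theorem IsAffineFun.exists_affFun_eq [∀ x, IsTopologicalAddGroup (V x)]
    [∀ x, ContinuousSMul ℝ (V x)] {g : TotalSpace F V → ℝ} (hg : IsAffineFun 𝓘(ℝ, E) g) :
    ∃ p : AffineDualSection E F V, ⇑(affFun p) = g := by
  let f : C^∞⟮𝓘(ℝ, E), M; ℝ⟯ := ⟨fun x => g ⟨x, 0⟩, hg.1.comp (contMDiff_zeroSection ℝ V)⟩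
  have hlin : IsLinearFun 𝓘(ℝ, E) fun u : TotalSpace F V => g u - f u.proj := by
    refine ⟨hg.1.sub (basicFun f).contMDiff, fun x => ?_⟩
    obtain ⟨φ, c, h⟩ := hg.2 x
    refine ⟨φ, fun w => ?_⟩
    change g ⟨x, w⟩ - g ⟨x, 0⟩ = φ w
    rw [h, h, map_zero, zero_add, add_sub_cancel_right]
  obtain ⟨a, ha⟩ := hlin.exists_linFun_eq
  exact ⟨(a, f), funext fun v => by rw [affFun_apply, ha, sub_add_cancel]⟩

theorem isCoordinateFamily_range_affFun :
    IsCoordinateFamily (Set.range (affFun : AffineDualSection E F V →ₗ[ℝ] _)) := by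
  intro v₀
  obtain ⟨ψ, hψ, -⟩ := isCoordinateFamily_univ (I := 𝓘(ℝ, E)) v₀.proj
  let e := trivializationAt F V v₀.proj
  let b := Module.finBasis ℝ F
  choose a ha using fun i => exists_dualSection_eventuallyEq (I := 𝓘(ℝ, E)) (W := V) v₀.proj
    (b.coord i).toContinuousLinearMap
  have hproj : Tendsto (fun u : TotalSpace F V => u.proj) (𝓝 v₀) (𝓝 v₀.proj) :=
    (FiberBundle.continuous_proj F V).continuousAt
  let Ψ : C^∞⟮𝓘(ℝ, E).prod 𝓘(ℝ, F), TotalSpace F V; 𝓘(ℝ, E × F), E × F⟯ :=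
    ⟨fun u => (ψ u.proj, ∑ i, linFun (a i) u • b i),
      (ψ.contMDiff.comp (contMDiff_proj V)).prodMk_space
        (contMDiff_finsetSum fun i _ => (contMDiff_linFun (a i)).smul contMDiff_const)⟩
  refine ⟨Ψ, ?_, fun c => ⟨_, ⟨(∑ i, c (0, b i) • a i,
    ⟨fun x => c (ψ x, 0), (c.comp (.inl ℝ E F)).contMDiff.comp ψ.contMDiff⟩), rfl⟩, fun u => ?_⟩⟩
  · filter_upwards [hproj hψ, hproj (eventually_all.2 ha), hproj (e.open_baseSet.mem_nhds
      (FiberBundle.mem_baseSet_trivializationAt' v₀.proj))] with u hψu hau hu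
    rw [FiberBundle.extChartAt]
    refine Prod.ext (hψu.trans (congrArg _ (e.coe_fst' hu)).symm) ?_
    calc ∑ i, linFun (a i) u • b i = ∑ i, b.repr (e u).2 i • b i :=
          Finset.sum_congr rfl fun i _ => congrArg (· • b i) (hau i u.snd)
      _ = (e u).2 := b.sum_repr _
  · let eval : DualSection 𝓘(ℝ, E) F V →ₗ[ℝ] ℝ :=
      { toFun := fun a => linFun a u, map_add' := fun _ _ => rfl, map_smul' := fun _ _ => rfl }
    calc eval (∑ i, c (0, b i) • a i) + c (ψ u.proj, 0)
        = c (0, ∑ i, linFun (a i) u • b i) + c (ψ u.proj, 0) := by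
          rw [← ContinuousLinearMap.inr_apply (R := ℝ) (M₁ := E), map_sum, map_sum, map_sum]
          simp only [map_smul, ContinuousLinearMap.inr_apply, smul_eq_mul]
          exact congrArg (· + _) (Finset.sum_congr rfl fun i _ => mul_comm _ _)
      _ = c (Ψ u) := by rw [← map_add, Prod.mk_add_mk, zero_add, add_zero]; rfl

end AffineFunctions

section VerticalLift

variable {E : Type*} [NormedAddCommGroup E] [NormedSpace ℝ E]
  {M : Type*} [TopologicalSpace M] [ChartedSpace E M]
  {F : Type*} [NormedAddCommGroup F] [NormedSpace ℝ F]
  {V : M → Type*} [TopologicalSpace (TotalSpace F V)]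
  [∀ x, AddCommGroup (V x)] [∀ x, Module ℝ (V x)] [∀ x, TopologicalSpace (V x)]
  [FiberBundle F V] [VectorBundle ℝ F V]

theorem contMDiff_fiberLine (v : TotalSpace F V) (w : V v.proj) :
    ContMDiff 𝓘(ℝ, ℝ) (𝓘(ℝ, E).prod 𝓘(ℝ, F)) ∞
      fun t : ℝ => (⟨v.proj, v.snd + t • w⟩ : TotalSpace F V) := by
  intro t
  let e := (trivializationAt F V v.proj).continuousLinearMapAt ℝ v.proj
  have he : (fun t : ℝ => (trivializationAt F V v.proj ⟨v.proj, v.snd + t • w⟩).2) =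
      fun t => e v.snd + t • e w := by
    funext t
    rw [← map_smul, ← map_add]
    exact (congrFun ((trivializationAt F V v.proj).coe_linearMapAt_of_mem
      (FiberBundle.mem_baseSet_trivializationAt' v.proj)) _).symm
  rw [contMDiffAt_totalSpace, he]
  exact ⟨contMDiffAt_const, contMDiffAt_const.add (contMDiffAt_id.smul contMDiffAt_const)⟩

theorem mvfderiv_verticalLift {g : TotalSpace F V → ℝ} {v : TotalSpace F V}
    (hg : MDifferentiableAt (𝓘(ℝ, E).prod 𝓘(ℝ, F)) 𝓘(ℝ, ℝ) g v) (w : V v.proj) :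
    mvfderiv (𝓘(ℝ, E).prod 𝓘(ℝ, F)) g v (verticalLift 𝓘(ℝ, E) F v w) =
      deriv (fun t : ℝ => g ⟨v.proj, v.snd + t • w⟩) 0 := by
  have h0 : (⟨v.proj, v.snd + (0 : ℝ) • w⟩ : TotalSpace F V) = v := by rw [zero_smul, add_zero]
  refine (mvfderiv_comp_apply_of_eq (I := 𝓘(ℝ, E).prod 𝓘(ℝ, F)) (I' := 𝓘(ℝ, ℝ)) (0 : ℝ) hg
    ((contMDiff_fiberLine (E := E) v w 0).mdifferentiableAt (by simp)) h0 (1 : ℝ)).symm.trans ?_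
  rw [mvfderiv, mfderiv_eq_fderiv]
  rfl

theorem mvfderiv_affFun_verticalLift (p : AffineDualSection E F V)
    (v : TotalSpace F V) (w : V v.proj) :
    mvfderiv (𝓘(ℝ, E).prod 𝓘(ℝ, F)) (affFun p) v (verticalLift 𝓘(ℝ, E) F v w) =
      p.1 v.proj w := by
  rw [mvfderiv_verticalLift ((affFun p).contMDiff.mdifferentiable (by simp) v)]
  have hline : (fun t : ℝ => affFun p ⟨v.proj, v.snd + t • w⟩) = fun t =>
      t * (p.1 v.proj w : ℝ) + affFun p v := by
    funext t
    change (p.1 v.proj (v.snd + t • w) : ℝ) + p.2 v.proj = t * (p.1 v.proj w : ℝ) +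
      ((p.1 v.proj v.snd : ℝ) + p.2 v.proj)
    rw [map_add, map_smul]
    exact (congrArg (· + p.2 v.proj) (add_comm _ _)).trans (add_assoc _ _ _)
  rw [hline, deriv_add_const, deriv_mul_const differentiableAt_id, deriv_id'', one_mul]

end VerticalLift

/-! ### Lie algebroids -/

section AlgebroidCalculus

variable {E : Type*} [NormedAddCommGroup E] [NormedSpace ℝ E]
  {H : Type*} [TopologicalSpace H] {I : ModelWithCorners ℝ E H}
  {M : Type*} [TopologicalSpace M] [ChartedSpace H M]
  {G : Type*} [NormedAddCommGroup G] [NormedSpace ℝ G]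
  {W : M → Type*} [TopologicalSpace (TotalSpace G W)]
  [∀ x, AddCommGroup (W x)] [∀ x, Module ℝ (W x)] [∀ x, TopologicalSpace (W x)]
  [FiberBundle G W] [VectorBundle ℝ G W]

/-- A skew-symmetric `C^∞(M)`-bilinear map, as an `ℝ`-bilinear map. -/
def SkewBilinear.toLinear (P : SkewBilinear I G W) :
    Cₛ^∞⟮I; G, W⟯ →ₗ[ℝ] Cₛ^∞⟮I; G, W⟯ →ₗ[ℝ] C^∞⟮I, M; ℝ⟯ :=
  have hsmul : ∀ (r : ℝ) a b, P.toFun a (r • b) = r • P.toFun a b := fun r a b =>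
    P.map_smul a (ContMDiffMap.const r) b
  LinearMap.mk₂ ℝ P.toFun
    (fun a b c => by rw [P.skew, P.map_add, neg_add, ← P.skew, ← P.skew])
    (fun r a b => by rw [P.skew, hsmul, ← smul_neg, ← P.skew]) P.map_add hsmul

variable [IsManifold I ∞ M]

namespace LieAlgebroid

variable (L : LieAlgebroid I G W)

/-- The bracket of a Lie algebroid, as an `ℝ`-bilinear map. -/
def bracketLinear : Cₛ^∞⟮I; G, W⟯ →ₗ[ℝ] Cₛ^∞⟮I; G, W⟯ →ₗ[ℝ] Cₛ^∞⟮I; G, W⟯ :=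
  LinearMap.mk₂ ℝ L.bracket
    (fun a b c => by rw [L.bracket_skew, L.bracket_add, neg_add, ← L.bracket_skew,
      ← L.bracket_skew])
    (fun r a b => by rw [L.bracket_skew, L.bracket_smul, ← smul_neg, ← L.bracket_skew])
    L.bracket_add L.bracket_smul

theorem bracket_bracket (a b c : Cₛ^∞⟮I; G, W⟯) : L.bracket (L.bracket a b) c =
    L.bracket a (L.bracket b c) - L.bracket b (L.bracket a c) := by
  have h := L.jacobi a b c
  rw [L.bracket_skew (L.bracket b c), L.bracket_skew c a, L.bracket_skew (-L.bracket a c),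
    show L.bracket b (-L.bracket a c) = -L.bracket b (L.bracket a c) from
      map_neg (L.bracketLinear b) _, neg_neg] at h
  rw [← sub_eq_zero, ← h]
  abel

/-- The vector field `ρ(a)` on the base. -/
def anchorField (a : Cₛ^∞⟮I; G, W⟯) : VectorField I M :=
  ⟨fun x => L.anchor x (a x), fun x => (L.anchor.contMDiff x).clm_bundle_apply (a.contMDiff x)⟩

variable [I.Boundaryless]

/-- The anchor, as a linear map from sections to derivations of `C^∞(M)`. -/
def rhoDerivation : Cₛ^∞⟮I; G, W⟯ →ₗ[ℝ] Derivation ℝ C^∞⟮I, M; ℝ⟯ C^∞⟮I, M; ℝ⟯ where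
  toFun a := (L.anchorField a).derivation
  map_add' a b := by
    ext f x
    exact (congrArg (mvfderiv I f x) (map_add (L.anchor x) (a x) (b x))).trans (map_add _ _ _)
  map_smul' r a := by
    ext f x
    exact (congrArg (mvfderiv I f x) (map_smul (L.anchor x) r (a x))).trans (map_smul _ _ _)

theorem bracket_smulSection (a : Cₛ^∞⟮I; G, W⟯) (f : C^∞⟮I, M; ℝ⟯) (b : Cₛ^∞⟮I; G, W⟯) :
    L.bracket a (smulSection f b) =
      smulSection f (L.bracket a b) + smulSection (L.rhoDerivation a f) b :=
  ContMDiffSection.ext (L.leibniz a f b)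

variable [FiniteDimensional ℝ E] [T2Space M] [FiniteDimensional ℝ G] [ContMDiffVectorBundle ∞ G W I]

theorem apply_bracket_of_apply_eq_zero {φ : Cₛ^∞⟮I; G, W⟯ →ₗ[ℝ] C^∞⟮I, M; ℝ⟯}
    (hφ : ∀ f s, φ (smulSection f s) = f * φ s) (a : Cₛ^∞⟮I; G, W⟯) {b : Cₛ^∞⟮I; G, W⟯} {x : M}
    (hb : b x = 0) : φ (L.bracket a b) x = L.rhoDerivation a (φ b) x := by
  let T : Cₛ^∞⟮I; G, W⟯ →+ C^∞⟮I, M; ℝ⟯ :=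
    (φ ∘ₗ L.bracketLinear a - L.rhoDerivation a ∘ₗ φ).toAddMonoidHom
  have hT : ∀ f s, T (smulSection f s) = f * T s := fun f s => by
    change φ (L.bracket a (smulSection f s)) - L.rhoDerivation a (φ (smulSection f s)) =
      f * (φ (L.bracket a s) - L.rhoDerivation a (φ s))
    rw [bracket_smulSection, map_add, hφ, hφ, hφ, Derivation.leibniz, smul_eq_mul, smul_eq_mul]
    ring
  exact sub_eq_zero.1 (map_eq_zero_of_apply_eq_zero
    ((ContMDiffMap.evalRingHom x).toAddMonoidHom.comp T)
    (fun f s => DFunLike.congr_fun (hT f s) x) hb)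

theorem rhoDerivation_bracket [Nontrivial G] (a b : Cₛ^∞⟮I; G, W⟯) (f : C^∞⟮I, M; ℝ⟯) :
    L.rhoDerivation (L.bracket a b) f =
      L.rhoDerivation a (L.rhoDerivation b f) - L.rhoDerivation b (L.rhoDerivation a f) := by
  ext x
  have := (VectorBundle.continuousLinearEquivAt ℝ G W x).toEquiv.nontrivial
  obtain ⟨w, hw⟩ := exists_ne (0 : W x)
  obtain ⟨c, rfl⟩ := exists_section_apply_eq I G w
  have hc := DFunLike.congr_fun (L.bracket_bracket a b c) x
  have hfc := DFunLike.congr_fun (L.bracket_bracket a b (smulSection f c)) x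
  simp only [bracket_smulSection, L.bracket_add] at hfc
  change f x • L.bracket (L.bracket a b) c x + L.rhoDerivation (L.bracket a b) f x • c x =
    f x • L.bracket a (L.bracket b c) x + L.rhoDerivation a f x • L.bracket b c x
      + (L.rhoDerivation b f x • L.bracket a c x
        + L.rhoDerivation a (L.rhoDerivation b f) x • c x)
      - (f x • L.bracket b (L.bracket a c) x + L.rhoDerivation b f x • L.bracket a c x
        + (L.rhoDerivation a f x • L.bracket b c x
          + L.rhoDerivation b (L.rhoDerivation a f) x • c x)) at hfc
  change L.bracket (L.bracket a b) c x = L.bracket a (L.bracket b c) x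
    - L.bracket b (L.bracket a c) x at hc
  refine smul_left_injective ℝ hw ?_
  change L.rhoDerivation (L.bracket a b) f x • c x = (L.rhoDerivation a (L.rhoDerivation b f) x
    - L.rhoDerivation b (L.rhoDerivation a f) x) • c x
  rw [eq_sub_of_add_eq' hfc, hc]
  module

end LieAlgebroid

end AlgebroidCalculus

section AffineBracket

variable {E : Type*} [NormedAddCommGroup E] [NormedSpace ℝ E]
  {M : Type*} [TopologicalSpace M] [ChartedSpace E M] [IsManifold 𝓘(ℝ, E) ∞ M]
  {F : Type*} [NormedAddCommGroup F] [NormedSpace ℝ F]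
  {V : M → Type*} [TopologicalSpace (TotalSpace F V)]
  [∀ x, AddCommGroup (V x)] [∀ x, Module ℝ (V x)] [∀ x, TopologicalSpace (V x)]
  [FiberBundle F V] [VectorBundle ℝ F V]
  (L : LieAlgebroid 𝓘(ℝ, E) (F →L[ℝ] ℝ) (DualFiber V)) (X : Cₛ^∞⟮𝓘(ℝ, E); F, V⟯)
  (P : SkewBilinear 𝓘(ℝ, E) (F →L[ℝ] ℝ) (DualFiber V))

/-- The bracket on sections of the affine dual which a Lie algebroid structure on `A^*`, a section
`X` of `A` and a 2-section `P` of `A` define; it is the Jacobi bracket of affine functions. -/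
def affineBracket :
    AffineDualSection E F V →ₗ[ℝ] AffineDualSection E F V →ₗ[ℝ] AffineDualSection E F V :=
  LinearMap.mk₂ ℝ
    (fun p q => (L.bracketLinear p.1 q.1, -P.toLinear p.1 q.1 - p.2 * pairingHom X q.1
      + q.2 * pairingHom X p.1 - L.rhoDerivation q.1 p.2 + L.rhoDerivation p.1 q.2))
    (fun p p' q => by
      ext : 1
      · exact L.bracketLinear.map_add₂ p.1 p'.1 q.1
      · simp only [Prod.fst_add, Prod.snd_add, map_add, LinearMap.add_apply, Derivation.add_apply]
        ring)
    (fun r p q => by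
      ext : 1
      · exact L.bracketLinear.map_smul₂ r p.1 q.1
      · simp only [Prod.smul_fst, Prod.smul_snd, map_smul, LinearMap.smul_apply,
          Derivation.smul_apply, Derivation.map_smul, smul_mul_assoc, mul_smul_comm, smul_add,
          smul_sub, smul_neg])
    (fun p q q' => by
      ext : 1
      · exact map_add (L.bracketLinear p.1) q.1 q'.1
      · simp only [Prod.fst_add, Prod.snd_add, map_add, Derivation.add_apply]
        ring)
    (fun r p q => by
      ext : 1
      · exact map_smul (L.bracketLinear p.1) r q.1
      · simp only [Prod.smul_fst, Prod.smul_snd, map_smul, Derivation.smul_apply,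
          Derivation.map_smul, smul_mul_assoc, mul_smul_comm, smul_add, smul_sub, smul_neg])

theorem affineBracket_apply (p q : AffineDualSection E F V) : affineBracket L X P p q =
    (L.bracket p.1 q.1, -P.toFun p.1 q.1 - p.2 * pairingHom X q.1 + q.2 * pairingHom X p.1
      - L.rhoDerivation q.1 p.2 + L.rhoDerivation p.1 q.2) :=
  rfl

/-- The value `Λ(dφ, dψ)` on affine functions `φ`, `ψ` of the bivector field for which
`affineBracket` is the Jacobi bracket `Λ(dφ, dψ) - φ X^v(ψ) + ψ X^v(φ)`. -/
def affineForm : AffineDualSection E F V →ₗ[ℝ] AffineDualSection E F V →ₗ[ℝ]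
    C^∞⟮𝓘(ℝ, E).prod 𝓘(ℝ, F), TotalSpace F V; ℝ⟯ :=
  LinearMap.mk₂ ℝ
    (fun p q => affFun (affineBracket L X P p q) + affFun p * basicFun (pairingHom X q.1)
      - affFun q * basicFun (pairingHom X p.1))
    (fun p p' q => by
      simp only [map_add, LinearMap.add_apply, Prod.fst_add]
      ring)
    (fun r p q => by
      rw [LinearMap.map_smul₂]
      simp only [map_smul, Prod.smul_fst, smul_add, smul_sub, smul_mul_assoc, mul_smul_comm])
    (fun p q q' => by
      simp only [map_add, Prod.fst_add]
      ring)
    (fun r p q => by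
      simp only [map_smul, Prod.smul_fst, smul_add, smul_sub, smul_mul_assoc, mul_smul_comm])

variable [FiniteDimensional ℝ E] [T2Space M] [FiniteDimensional ℝ F]
  [ContMDiffVectorBundle ∞ F V 𝓘(ℝ, E)]

theorem snd_jacobiator_affineBracket [Nontrivial F] (p q r : AffineDualSection E F V) (x : M) :
    (jacobiator (affineBracket L X P · ·) p q r).2 x =
      L.d₂ (fun a b => P.toFun a b) p.1 q.1 r.1 x
      + wedge₁₂ (pairing X) (fun a b => P.toFun a b) p.1 q.1 r.1 x
      - (p.2 x * L.d₁ (pairing X) q.1 r.1 x + q.2 x * L.d₁ (pairing X) r.1 p.1 x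
        + r.2 x * L.d₁ (pairing X) p.1 q.1 x) := by
  let ρ := L.rhoDerivation
  let ξ := pairingHom X
  let d₁ (a b : DualSection 𝓘(ℝ, E) F V) := ρ a (ξ b) - ρ b (ξ a) - ξ (L.bracket a b)
  let d₂ (a b c : DualSection 𝓘(ℝ, E) F V) := ρ a (P.toFun b c) - ρ b (P.toFun a c)
    + ρ c (P.toFun a b) - P.toFun (L.bracket a b) c + P.toFun (L.bracket a c) b
    - P.toFun (L.bracket b c) a
  let wedge (a b c : DualSection 𝓘(ℝ, E) F V) :=
    ξ a * P.toFun b c - ξ b * P.toFun a c + ξ c * P.toFun a b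
  suffices h : (jacobiator (affineBracket L X P · ·) p q r).2 =
      d₂ p.1 q.1 r.1 + wedge p.1 q.1 r.1 - (p.2 * d₁ q.1 r.1 + q.2 * d₁ r.1 p.1
        + r.2 * d₁ p.1 q.1) from DFunLike.congr_fun h x
  have hP : P.toFun (L.bracket p.1 r.1) q.1 = -P.toFun (L.bracket r.1 p.1) q.1 := by
    rw [L.bracket_skew]
    exact LinearMap.congr_fun (map_neg P.toLinear _) _
  simp only [jacobiator, affineBracket_apply, Prod.snd_add, d₂, wedge, d₁, ρ, ξ, map_add, map_sub,
    map_neg, Derivation.leibniz, smul_eq_mul, L.rhoDerivation_bracket, hP, P.skew p.1 r.1]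
  ring

end AffineBracket

section AffineBracketJacobi

variable {E : Type*} [NormedAddCommGroup E] [NormedSpace ℝ E]
  {M : Type*} [TopologicalSpace M] [ChartedSpace E M] [IsManifold 𝓘(ℝ, E) ∞ M]
  {F : Type*} [NormedAddCommGroup F] [NormedSpace ℝ F]
  {V : M → Type*} [TopologicalSpace (TotalSpace F V)]
  [∀ x, AddCommGroup (V x)] [∀ x, Module ℝ (V x)] [∀ x, TopologicalSpace (V x)]
  [FiberBundle F V] [VectorBundle ℝ F V]
  (L : LieAlgebroid 𝓘(ℝ, E) (F →L[ℝ] ℝ) (DualFiber V)) (X : Cₛ^∞⟮𝓘(ℝ, E); F, V⟯)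
  (P : SkewBilinear 𝓘(ℝ, E) (F →L[ℝ] ℝ) (DualFiber V))

theorem affineBracket_skew (p q : AffineDualSection E F V) :
    affineBracket L X P p q = -affineBracket L X P q p := by
  ext : 1
  · exact L.bracket_skew p.1 q.1
  · simp only [affineBracket_apply, Prod.snd_neg, P.skew p.1 q.1]
    ring

theorem affineForm_apply (p q : AffineDualSection E F V) : affineForm L X P p q =
    affFun (affineBracket L X P p q) + affFun p * basicFun (pairingHom X q.1)
      - affFun q * basicFun (pairingHom X p.1) :=
  rfl

theorem affineForm_skew (p q : AffineDualSection E F V) :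
    affineForm L X P p q = -affineForm L X P q p := by
  rw [affineForm_apply, affineForm_apply, affineBracket_skew, map_neg]
  ring

variable [FiniteDimensional ℝ E] [T2Space M] [FiniteDimensional ℝ F]
  [ContMDiffVectorBundle ∞ F V 𝓘(ℝ, E)]

theorem affineForm_apply_eq_zero (p : AffineDualSection E F V) {q : AffineDualSection E F V}
    {v : TotalSpace F V} (hq : mvfderiv (𝓘(ℝ, E).prod 𝓘(ℝ, F)) (affFun q) v = 0) :
    affineForm L X P p q v = 0 := by
  have hb : q.1 v.proj = 0 := by
    ext w
    exact (mvfderiv_affFun_verticalLift q v w).symm.trans (DFunLike.congr_fun hq _)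
  obtain ⟨σ, hσ⟩ := exists_section_apply_eq 𝓘(ℝ, E) F v.snd
  have hσq : L.rhoDerivation p.1 (pairingHom σ q.1 + q.2) v.proj = 0 := by
    refine (mvfderiv_comp_apply_of_eq (f := fun x => (⟨x, σ x⟩ : TotalSpace F V)) v.proj
      ((affFun q).contMDiff.mdifferentiable (by simp) v)
      ((σ.contMDiff v.proj).mdifferentiableAt (by simp)) (congrArg (TotalSpace.mk v.proj) hσ)
      (L.anchor v.proj (p.1 v.proj))).trans ?_
    rw [hq]
    rfl
  have hbracket : linFun (L.bracket p.1 q.1) v = L.rhoDerivation p.1 (pairingHom σ q.1) v.proj := by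
    rw [← L.apply_bracket_of_apply_eq_zero (φ := pairingHom σ) (fun _ _ => rfl) p.1 hb]
    exact congrArg (L.bracket p.1 q.1 v.proj) hσ.symm
  have hP : P.toFun p.1 q.1 v.proj = 0 := map_eq_zero_of_apply_eq_zero
    ((ContMDiffMap.evalRingHom v.proj).toAddMonoidHom.comp (P.toLinear p.1).toAddMonoidHom)
    (fun f s => DFunLike.congr_fun (P.map_smul p.1 f s) v.proj) hb
  have hXb : pairingHom X q.1 v.proj = 0 := DFunLike.congr_fun hb (X v.proj)
  have hlin : linFun q.1 v = 0 := DFunLike.congr_fun hb v.snd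
  have hrho : L.rhoDerivation q.1 p.2 v.proj = 0 := by
    change mvfderiv 𝓘(ℝ, E) p.2 v.proj (L.anchor v.proj (q.1 v.proj)) = 0
    rw [hb, map_zero, map_zero]
  rw [map_add] at hσq
  change L.rhoDerivation p.1 (pairingHom σ q.1) v.proj + L.rhoDerivation p.1 q.2 v.proj = 0 at hσq
  change linFun (L.bracket p.1 q.1) v + (-P.toFun p.1 q.1 v.proj
      - p.2 v.proj * pairingHom X q.1 v.proj + q.2 v.proj * pairingHom X p.1 v.proj
      - L.rhoDerivation q.1 p.2 v.proj + L.rhoDerivation p.1 q.2 v.proj)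
    + affFun p v * pairingHom X q.1 v.proj
    - (linFun q.1 v + q.2 v.proj) * pairingHom X p.1 v.proj = 0
  rw [hbracket, hP, hXb, hlin, hrho]
  linear_combination hσq

theorem jacobiator_affineBracket_eq_zero_iff [Nontrivial F] :
    (∀ p q r, jacobiator (affineBracket L X P · ·) p q r = 0) ↔
      (∀ a b x, L.d₁ (pairing X) a b x = 0) ∧
      ∀ a b c x, L.d₂ (fun s t => P.toFun s t) a b c x =
        -wedge₁₂ (pairing X) (fun s t => P.toFun s t) a b c x := by
  refine ⟨fun h => ?_, fun ⟨hcocycle, htwist⟩ p q r => ?_⟩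
  · have htwist : ∀ a b c x, L.d₂ (fun s t => P.toFun s t) a b c x =
        -wedge₁₂ (pairing X) (fun s t => P.toFun s t) a b c x := fun a b c x => by
      have habc := snd_jacobiator_affineBracket L X P (a, 0) (b, 0) (c, 0) x
      rw [h] at habc
      change (0 : ℝ) = _ - (0 * _ + 0 * _ + 0 * _) at habc
      linarith
    refine ⟨fun a b x => ?_, htwist⟩
    have hab := snd_jacobiator_affineBracket L X P (a, 0) (b, 0) (0, 1) x
    rw [h] at hab
    change (0 : ℝ) = _ - (0 * _ + 0 * _ + 1 * _) at hab
    have := htwist a b 0 x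
    linarith
  · ext x : 2
    · exact DFunLike.congr_fun (L.jacobi p.1 q.1 r.1) x
    · rw [snd_jacobiator_affineBracket, hcocycle, hcocycle, hcocycle, htwist]
      change _ = (0 : ℝ)
      ring

end AffineBracketJacobi

section AffineJacobi

variable {E : Type*} [NormedAddCommGroup E] [NormedSpace ℝ E] [FiniteDimensional ℝ E]
  {M : Type*} [TopologicalSpace M] [T2Space M] [ChartedSpace E M] [IsManifold 𝓘(ℝ, E) ∞ M]
  {F : Type*} [NormedAddCommGroup F] [NormedSpace ℝ F] [FiniteDimensional ℝ F]
  {V : M → Type*} [TopologicalSpace (TotalSpace F V)]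
  [∀ x, AddCommGroup (V x)] [∀ x, Module ℝ (V x)] [∀ x, TopologicalSpace (V x)]
  [FiberBundle F V] [VectorBundle ℝ F V] [ContMDiffVectorBundle ∞ F V 𝓘(ℝ, E)]
  (L : LieAlgebroid 𝓘(ℝ, E) (F →L[ℝ] ℝ) (DualFiber V)) (X : Cₛ^∞⟮𝓘(ℝ, E); F, V⟯)
  (P : SkewBilinear 𝓘(ℝ, E) (F →L[ℝ] ℝ) (DualFiber V))

theorem exists_affineBivector :
    ∃ Λ : BivectorField (𝓘(ℝ, E).prod 𝓘(ℝ, F)) (TotalSpace F V),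
      ∀ p q, Λ.biderivation (affFun p) (affFun q) = affineForm L X P p q := by
  let eval (v : TotalSpace F V) :
      C^∞⟮𝓘(ℝ, E).prod 𝓘(ℝ, F), TotalSpace F V; ℝ⟯ →ₗ[ℝ] ℝ :=
    { toFun := fun g => g v, map_add' := fun _ _ => rfl, map_smul' := fun _ _ => rfl }
  obtain ⟨Λ, hΛ⟩ := isCoordinateFamily_range_affFun.exists_bivectorField
    (B := fun v => (affineForm L X P).compr₂ (eval v))
    (fun v p => self_eq_neg.1 (DFunLike.congr_fun (affineForm_skew L X P p p) v))
    (fun v p q => affineForm_apply_eq_zero L X P p)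
    (fun p q => (affineForm L X P p q).contMDiff)
  exact ⟨Λ, fun p q => ContMDiffMap.ext (hΛ p q)⟩

/-- The bivector field `Λ_A` for which `affineBracket` is the Jacobi bracket of affine functions. -/
def affineBivector : BivectorField (𝓘(ℝ, E).prod 𝓘(ℝ, F)) (TotalSpace F V) :=
  (exists_affineBivector L X P).choose

theorem affineBivector_biderivation (p q : AffineDualSection E F V) :
    (affineBivector L X P).biderivation (affFun p) (affFun q) = affineForm L X P p q :=
  (exists_affineBivector L X P).choose_spec p q

/-- The vector field `-X^v`. -/
def negSectionLift : VectorField (𝓘(ℝ, E).prod 𝓘(ℝ, F)) (TotalSpace F V) :=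
  ⟨fun v => -sectionLift X v, isCoordinateFamily_range_affFun.contMDiff_vectorField (by
    rintro _ ⟨p, rfl⟩
    have hact : (fun v => mvfderiv (𝓘(ℝ, E).prod 𝓘(ℝ, F)) (affFun p) v (-sectionLift X v)) =
        fun v => -pairing X p.1 v.proj :=
      funext fun v => (map_neg _ _).trans (congrArg Neg.neg (mvfderiv_affFun_verticalLift p v _))
    rw [hact]
    exact (-basicFun (pairingHom X p.1)).contMDiff)⟩

theorem negSectionLift_derivation (p : AffineDualSection E F V) :
    (negSectionLift X).derivation (affFun p) = -basicFun (pairingHom X p.1) :=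
  ContMDiffMap.ext fun v =>
    (map_neg _ _).trans (congrArg Neg.neg (mvfderiv_affFun_verticalLift p v _))

theorem derivationBracket_affFun (p q : AffineDualSection E F V) :
    derivationBracket (affineBivector L X P).biderivation (negSectionLift X).derivation
      (affFun p) (affFun q) = affFun (affineBracket L X P p q) := by
  rw [derivationBracket, affineBivector_biderivation, negSectionLift_derivation,
    negSectionLift_derivation, affineForm_apply]
  ring

/-- The Jacobi structure `(Λ_A, -X^v)`. -/
def affineJacobi [Nontrivial F] (hcocycle : ∀ a b x, L.d₁ (pairing X) a b x = 0)
    (htwist : ∀ a b c x, L.d₂ (fun s t => P.toFun s t) a b c x =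
      -wedge₁₂ (pairing X) (fun s t => P.toFun s t) a b c x) :
    JacobiStructure (𝓘(ℝ, E).prod 𝓘(ℝ, F)) (TotalSpace F V) :=
  isCoordinateFamily_range_affFun.jacobiStructure (Λ := affineBivector L X P)
    (X := negSectionLift X) ⟨(0, 1), ContMDiffMap.ext fun _ => zero_add 1⟩ (by
      rintro _ ⟨p, rfl⟩ _ ⟨q, rfl⟩ _ ⟨r, rfl⟩
      simp only [jacobiator, derivationBracket_affFun, ← map_add]
      exact (congrArg affFun ((jacobiator_affineBracket_eq_zero_iff L X P).2
        ⟨hcocycle, htwist⟩ p q r)).trans (map_zero affFun))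

variable [∀ x, IsTopologicalAddGroup (V x)] [∀ x, ContinuousSMul ℝ (V x)]

/-- The strongly-affine Jacobi structure of a Jacobi algebroid structure on `A^*` twisted by a
2-section of `A`. -/
def TwistedJacobiAlgebroid.toStronglyAffine [Nontrivial F]
    (D : TwistedJacobiAlgebroid 𝓘(ℝ, E) F V) : StronglyAffineJacobi 𝓘(ℝ, E) F V where
  toJacobiStructure := affineJacobi D.toLieAlgebroid D.X₀ D.P₀ D.cocycle D.twist
  affine f g hf hg := by
    obtain ⟨p, rfl⟩ := hf.exists_affFun_eq
    obtain ⟨q, rfl⟩ := hg.exists_affFun_eq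
    have h := isAffineFun_affFun (affineBracket D.toLieAlgebroid D.X₀ D.P₀ p q)
    rwa [← derivationBracket_affFun] at h
  hamiltonian_affine f g hf hg := by
    obtain ⟨p, rfl⟩ := hf.exists_affFun_eq
    obtain ⟨q, rfl⟩ := hg.exists_affFun_eq
    let ξ := pairingHom D.X₀ p.1
    let Λ := (affineBivector D.toLieAlgebroid D.X₀ D.P₀).biderivation
    let Y := (negSectionLift D.X₀).derivation
    let r := affineBracket D.toLieAlgebroid D.X₀ D.P₀ p q - (smulSection ξ q.1, ξ * q.2)
    have hr : affFun r = Λ (affFun p) (affFun q) + affFun p * Y (affFun q) := by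
      rw [map_sub, affFun_smulSection, ← derivationBracket_affFun, derivationBracket,
        negSectionLift_derivation D.X₀ p]
      ring
    have h := isAffineFun_affFun r
    rwa [hr] at h

end AffineJacobi

/-! ### The algebroid of a strongly-affine Jacobi structure -/

theorem exists_linearMap_lift {R P Q T : Type*} [CommRing R] [AddCommGroup P] [Module R P]
    [AddCommGroup Q] [Module R Q] [AddCommGroup T] [Module R T] {φ : P →ₗ[R] Q}
    (hφ : Function.Injective φ) (t : T →ₗ[R] Q) (ht : ∀ x, t x ∈ LinearMap.range φ) :
    ∃ s : T →ₗ[R] P, φ ∘ₗ s = t :=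
  ⟨(LinearEquiv.ofInjective φ hφ).symm ∘ₗ t.codRestrict _ ht, LinearMap.ext fun x =>
    congrArg Subtype.val ((LinearEquiv.ofInjective φ hφ).apply_symm_apply ⟨t x, ht x⟩)⟩

section BasicFunctions

variable {E : Type*} [NormedAddCommGroup E] [NormedSpace ℝ E]
  {M : Type*} [TopologicalSpace M] [ChartedSpace E M]
  {F : Type*} [NormedAddCommGroup F] [NormedSpace ℝ F]
  {V : M → Type*} [TopologicalSpace (TotalSpace F V)]
  [∀ x, AddCommGroup (V x)] [∀ x, Module ℝ (V x)] [∀ x, TopologicalSpace (V x)]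
  [FiberBundle F V] [VectorBundle ℝ F V]

theorem affFun_zero_left (f : C^∞⟮𝓘(ℝ, E), M; ℝ⟯) :
    affFun ((0, f) : AffineDualSection E F V) = basicFun f :=
  ContMDiffMap.ext fun _ => zero_add _

theorem affFun_eq_add (p : AffineDualSection E F V) :
    affFun p = affFun (p.1, 0) + basicFun p.2 := by
  rw [← affFun_zero_left (V := V), ← map_add, Prod.mk_add_mk, add_zero, zero_add]

theorem affFun_smulSection_zero (f : C^∞⟮𝓘(ℝ, E), M; ℝ⟯) (a : DualSection 𝓘(ℝ, E) F V) :
    affFun (smulSection f a, 0) = basicFun f * affFun (a, 0) := by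
  rw [← affFun_smulSection, mul_zero]

omit [∀ x, Module ℝ (V x)] [VectorBundle ℝ F V] in
theorem basicFun_injective : Function.Injective
    (basicFun : C^∞⟮𝓘(ℝ, E), M; ℝ⟯ →ₐ[ℝ] C^∞⟮𝓘(ℝ, E).prod 𝓘(ℝ, F), TotalSpace F V; ℝ⟯) :=
  fun _ _ h => ContMDiffMap.ext fun x => DFunLike.congr_fun h (⟨x, 0⟩ : TotalSpace F V)

theorem basicFun_mul_mem_range_affFun (f : C^∞⟮𝓘(ℝ, E), M; ℝ⟯)
    {g : C^∞⟮𝓘(ℝ, E).prod 𝓘(ℝ, F), TotalSpace F V; ℝ⟯} (hg : g ∈ LinearMap.range affFun) :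
    basicFun f * g ∈ LinearMap.range affFun := by
  obtain ⟨p, rfl⟩ := hg
  exact ⟨_, affFun_smulSection f p⟩

theorem mem_range_basicFun_of_mul_self_mem
    {g : C^∞⟮𝓘(ℝ, E).prod 𝓘(ℝ, F), TotalSpace F V; ℝ⟯} (hg : g ∈ LinearMap.range affFun)
    (hgg : g * g ∈ LinearMap.range affFun) : g ∈ basicFun.range := by
  obtain ⟨⟨a, f⟩, rfl⟩ := hg
  obtain ⟨⟨b, h⟩, hb⟩ := hgg
  have hcompare : ∀ α β γ δ : ℝ, β + δ = (α + γ) * (α + γ) →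
      -β + δ = (-α + γ) * (-α + γ) → 0 + δ = (0 + γ) * (0 + γ) → α = 0 :=
    fun α β γ δ hpos hneg hzero => mul_self_eq_zero.1 (by linarith)
  have ha : a = 0 := by
    ext x w
    have hsq : ∀ w : V x, (b x w : ℝ) + h x = ((a x w : ℝ) + f x) * ((a x w : ℝ) + f x) :=
      fun w => DFunLike.congr_fun hb (⟨x, w⟩ : TotalSpace F V)
    have hneg := hsq (-w)
    have hzero := hsq 0
    rw [(map_neg (a x) w :), (map_neg (b x) w :)] at hneg
    rw [(map_zero (a x) :), (map_zero (b x) :)] at hzero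
    exact hcompare _ _ _ _ (hsq w) hneg hzero
  exact ⟨f, by rw [ha]; exact (affFun_zero_left f).symm⟩

variable [FiniteDimensional ℝ E] [T2Space M] [IsManifold 𝓘(ℝ, E) ∞ M] [FiniteDimensional ℝ F]
  [ContMDiffVectorBundle ∞ F V 𝓘(ℝ, E)]

theorem eq_zero_of_forall_mul_linFun_basic [Nontrivial F] {h : C^∞⟮𝓘(ℝ, E), M; ℝ⟯}
    (hh : ∀ a : DualSection 𝓘(ℝ, E) F V, basicFun h * affFun (a, 0) ∈ basicFun.range) : h = 0 := by
  ext x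
  have := (VectorBundle.continuousLinearEquivAt ℝ F V x).toEquiv.nontrivial
  obtain ⟨w, hw⟩ := exists_ne (0 : V x)
  by_contra hx
  refine hw (eq_of_forall_dualSection (I := 𝓘(ℝ, E)) (G := F) fun a => ?_)
  obtain ⟨k, hk⟩ := hh a
  have hw := DFunLike.congr_fun hk (⟨x, w⟩ : TotalSpace F V)
  have h0 := DFunLike.congr_fun hk (⟨x, 0⟩ : TotalSpace F V)
  change k x = h x * ((a x w : ℝ) + 0) at hw
  change k x = h x * ((a x 0 : ℝ) + 0) at h0
  exact add_right_cancel (mul_left_cancel₀ hx (hw.symm.trans h0))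

theorem derivation_basicFun_eq_zero [Nontrivial F]
    {D : Derivation ℝ C^∞⟮𝓘(ℝ, E).prod 𝓘(ℝ, F), TotalSpace F V; ℝ⟯
      C^∞⟮𝓘(ℝ, E).prod 𝓘(ℝ, F), TotalSpace F V; ℝ⟯}
    (hD : ∀ p : AffineDualSection E F V, D (affFun p) ∈ basicFun.range)
    (f : C^∞⟮𝓘(ℝ, E), M; ℝ⟯) : D (basicFun f) = 0 := by
  obtain ⟨h, hh⟩ := hD (0, f)
  replace hh : basicFun h = D (basicFun f) := hh.trans (congrArg D (affFun_zero_left f))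
  rw [← hh, eq_zero_of_forall_mul_linFun_basic (F := F) (V := V) (h := h), map_zero]
  intro a
  have hleibniz : basicFun h * affFun (a, 0) =
      D (affFun (smulSection f a, f * 0)) - basicFun f * D (affFun (a, 0)) := by
    rw [affFun_smulSection f (a, 0), Derivation.leibniz, hh, smul_eq_mul, smul_eq_mul]
    ring
  rw [hleibniz]
  exact sub_mem (hD _) (mul_mem ⟨f, rfl⟩ (hD _))

omit [FiniteDimensional ℝ F] in
theorem exists_vectorField_of_projectable
    (Y : VectorField (𝓘(ℝ, E).prod 𝓘(ℝ, F)) (TotalSpace F V))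
    (hY : ∀ f, Y.derivation (basicFun f) ∈ basicFun.range) :
    ∃ ξ : VectorField 𝓘(ℝ, E) M, ∀ f, basicFun (ξ.derivation f) = Y.derivation (basicFun f) := by
  let ξ : ∀ x : M, TangentSpace 𝓘(ℝ, E) x := fun x =>
    mfderiv (𝓘(ℝ, E).prod 𝓘(ℝ, F)) 𝓘(ℝ, E) TotalSpace.proj (⟨x, 0⟩ : TotalSpace F V) (Y ⟨x, 0⟩)
  have hξ : ∀ (f : C^∞⟮𝓘(ℝ, E), M; ℝ⟯) (x : M), mvfderiv 𝓘(ℝ, E) f x (ξ x) =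
      Y.derivation (basicFun f) ⟨x, 0⟩ := fun f x =>
    (mvfderiv_comp_apply_of_eq (⟨x, 0⟩ : TotalSpace F V) (f.contMDiff.mdifferentiable (by simp) x)
      ((contMDiff_proj V (n := ∞)).mdifferentiable (by simp) _) rfl (Y ⟨x, 0⟩)).symm
  refine ⟨⟨ξ, isCoordinateFamily_univ.contMDiff_vectorField fun f _ => ?_⟩, fun f => ?_⟩
  · exact ((Y.derivation (basicFun f)).contMDiff.comp (contMDiff_zeroSection ℝ V)).congr (hξ f)
  · obtain ⟨k, hk⟩ := hY f
    rw [← hk]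
    refine congrArg basicFun (ContMDiffMap.ext fun x => (hξ f x).trans ?_)
    rw [← hk]
    rfl

end BasicFunctions

namespace StronglyAffineJacobi

variable {E : Type*} [NormedAddCommGroup E] [NormedSpace ℝ E] [FiniteDimensional ℝ E]
  {M : Type*} [TopologicalSpace M] [T2Space M] [ChartedSpace E M] [IsManifold 𝓘(ℝ, E) ∞ M]
  {F : Type*} [NormedAddCommGroup F] [NormedSpace ℝ F] [FiniteDimensional ℝ F]
  {V : M → Type*} [TopologicalSpace (TotalSpace F V)]
  [∀ x, AddCommGroup (V x)] [∀ x, Module ℝ (V x)] [∀ x, TopologicalSpace (V x)]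
  [∀ x, IsTopologicalAddGroup (V x)] [∀ x, ContinuousSMul ℝ (V x)]
  [FiberBundle F V] [VectorBundle ℝ F V] [ContMDiffVectorBundle ∞ F V 𝓘(ℝ, E)]
  (S : StronglyAffineJacobi 𝓘(ℝ, E) F V)

theorem derivationBracket_mem_range_affFun (p q : AffineDualSection E F V) :
    derivationBracket S.Λ.biderivation S.E.derivation (affFun p) (affFun q) ∈
      LinearMap.range affFun := by
  obtain ⟨r, hr⟩ :=
    (S.affine _ _ (isAffineFun_affFun p) (isAffineFun_affFun q)).exists_affFun_eq
  exact ⟨r, DFunLike.coe_injective hr⟩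

theorem hamiltonian_mem_range_affFun (p q : AffineDualSection E F V) :
    S.Λ.biderivation (affFun p) (affFun q) + affFun p * S.E.derivation (affFun q) ∈
      LinearMap.range affFun := by
  obtain ⟨r, hr⟩ :=
    (S.hamiltonian_affine _ _ (isAffineFun_affFun p) (isAffineFun_affFun q)).exists_affFun_eq
  exact ⟨r, DFunLike.coe_injective hr⟩

theorem affFun_mul_derivation_mem_range_affFun (p q : AffineDualSection E F V) :
    affFun p * S.E.derivation (affFun q) ∈ LinearMap.range affFun := by
  have h := sub_mem (S.hamiltonian_mem_range_affFun q p) (S.derivationBracket_mem_range_affFun q p)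
  rwa [derivationBracket, sub_sub_cancel] at h

theorem derivation_affFun_mem_range_basicFun (p : AffineDualSection E F V) :
    S.E.derivation (affFun p) ∈ basicFun.range := by
  have haff := S.affFun_mul_derivation_mem_range_affFun (0, 1) p
  rw [affFun_zero_left, map_one, one_mul] at haff
  refine mem_range_basicFun_of_mul_self_mem haff ?_
  obtain ⟨r, hr⟩ := haff
  have h := S.affFun_mul_derivation_mem_range_affFun r p
  rwa [hr] at h

theorem derivation_basicFun [Nontrivial F] (f : C^∞⟮𝓘(ℝ, E), M; ℝ⟯) :
    S.E.derivation (basicFun f) = 0 :=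
  derivation_basicFun_eq_zero S.derivation_affFun_mem_range_basicFun f

theorem biderivation_mem_range_affFun (p q : AffineDualSection E F V) :
    S.Λ.biderivation (affFun p) (affFun q) ∈ LinearMap.range affFun := by
  have h := sub_mem (S.hamiltonian_mem_range_affFun p q)
    (S.affFun_mul_derivation_mem_range_affFun p q)
  rwa [add_sub_cancel_right] at h

theorem biderivation_basicFun_mem_range_basicFun (f : C^∞⟮𝓘(ℝ, E), M; ℝ⟯)
    (q : AffineDualSection E F V) :
    S.Λ.biderivation (basicFun f) (affFun q) ∈ basicFun.range := by
  have hmul : ∀ p : AffineDualSection E F V,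
      affFun p * S.Λ.biderivation (basicFun f) (affFun q) ∈ LinearMap.range affFun := fun p => by
    have h := sub_mem (S.biderivation_mem_range_affFun (smulSection f p.1, f * p.2) q)
      (basicFun_mul_mem_range_affFun f (S.biderivation_mem_range_affFun p q))
    rwa [affFun_smulSection, leibniz_left S.Λ.biderivation_skew, add_sub_cancel_left] at h
  have haff := S.biderivation_mem_range_affFun (0, f) q
  rw [affFun_zero_left] at haff
  refine mem_range_basicFun_of_mul_self_mem haff ?_
  obtain ⟨r, hr⟩ := haff
  have h := hmul r
  rwa [hr] at h

theorem biderivation_basicFun_basicFun [Nontrivial F] (f g : C^∞⟮𝓘(ℝ, E), M; ℝ⟯) :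
    S.Λ.biderivation (basicFun f) (basicFun g) = 0 :=
  derivation_basicFun_eq_zero (S.biderivation_basicFun_mem_range_basicFun f) g

theorem exists_cocycle [Nontrivial F] : ∃ X : Cₛ^∞⟮𝓘(ℝ, E); F, V⟯,
    ∀ p, S.E.derivation (affFun p) = -basicFun (pairingHom X p.1) := by
  obtain ⟨T, hT⟩ := exists_linearMap_lift (φ := basicFun.toLinearMap)
    (basicFun_injective (V := V)) (-S.E.derivation.toLinearMap ∘ₗ affFun ∘ₗ LinearMap.inl ℝ
      (DualSection 𝓘(ℝ, E) F V) _) fun a => neg_mem (S.derivation_affFun_mem_range_basicFun (a, 0))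
  replace hT : ∀ a, basicFun (T a) = -S.E.derivation (affFun (a, 0)) := LinearMap.congr_fun hT
  obtain ⟨X, rfl⟩ := exists_section_of_tensorial T fun f a => basicFun_injective (V := V) (by
    rw [map_mul, hT, hT, affFun_smulSection_zero, Derivation.leibniz, derivation_basicFun,
      smul_zero, add_zero, smul_eq_mul, mul_neg])
  exact ⟨X, fun p => by rw [hT, neg_neg, affFun_eq_add p, map_add, derivation_basicFun, add_zero]⟩

theorem biderivation_affFun_basicFun_mem_range_basicFun (a : DualSection 𝓘(ℝ, E) F V)
    (f : C^∞⟮𝓘(ℝ, E), M; ℝ⟯) :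
    S.Λ.biderivation (affFun (a, 0)) (basicFun f) ∈ basicFun.range := by
  rw [S.Λ.biderivation_skew]
  exact neg_mem (S.biderivation_basicFun_mem_range_basicFun f (a, 0))

theorem exists_anchor [Nontrivial F] :
    ∃ ρ : Cₛ^∞⟮𝓘(ℝ, E); (F →L[ℝ] ℝ) →L[ℝ] E,
        fun x : M => DualFiber V x →L[ℝ] TangentSpace 𝓘(ℝ, E) x⟯,
      ∀ (a : DualSection 𝓘(ℝ, E) F V) (f : C^∞⟮𝓘(ℝ, E), M; ℝ⟯) (v : TotalSpace F V),
        S.Λ.biderivation (affFun (a, 0)) (basicFun f) v =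
          mvfderiv 𝓘(ℝ, E) f v.proj (ρ v.proj (a v.proj)) := by
  have hproj : ∀ a : DualSection 𝓘(ℝ, E) F V, ∃ ξ : VectorField 𝓘(ℝ, E) M,
      ∀ f, basicFun (ξ.derivation f) = S.Λ.biderivation (affFun (a, 0)) (basicFun f) := fun a => by
    obtain ⟨Y, hY⟩ := isCoordinateFamily_range_affFun.exists_hamiltonian S.Λ (affFun (a, 0))
    rw [← hY]
    exact exists_vectorField_of_projectable Y fun f => by
      rw [hY]
      exact S.biderivation_affFun_basicFun_mem_range_basicFun a f
  choose ξ hξ using hproj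
  have hext : ∀ {η ζ : VectorField 𝓘(ℝ, E) M},
      (∀ f, basicFun (V := V) (F := F) (η.derivation f) = basicFun (ζ.derivation f)) → η = ζ :=
    fun h => ContMDiffSection.ext fun x => isCoordinateFamily_univ.tangent_ext fun f _ =>
      DFunLike.congr_fun (basicFun_injective (V := V) (h f)) x
  have hadd : ∀ a b, ξ (a + b) = ξ a + ξ b := fun a b => hext fun f => by
    have hsum : (ξ a + ξ b).derivation f = (ξ a).derivation f + (ξ b).derivation f :=
      ContMDiffMap.ext fun x => map_add (mvfderiv 𝓘(ℝ, E) f x) (ξ a x) (ξ b x)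
    rw [hsum, map_add, hξ, hξ, hξ, ← Derivation.add_apply, ← map_add, ← map_add, Prod.mk_add_mk,
      add_zero]
  have hsmul : ∀ f a, ξ (smulSection f a) = smulSection f (ξ a) := fun f a => hext fun g => by
    have hmul : VectorField.derivation (smulSection f (ξ a)) g = f * (ξ a).derivation g :=
      ContMDiffMap.ext fun x => map_smul (mvfderiv 𝓘(ℝ, E) g x) (f x) (ξ a x)
    rw [hmul, map_mul, hξ, hξ, affFun_smulSection_zero, leibniz_left S.Λ.biderivation_skew,
      biderivation_basicFun_basicFun, mul_zero, add_zero]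
  obtain ⟨ρ, hρ⟩ := exists_hom_of_tensorial (AddMonoidHom.mk' ξ hadd) hsmul
  refine ⟨ρ, fun a f v => ?_⟩
  rw [hρ, ← hξ]
  rfl

/-- The bracket of sections of the affine dual which corresponds to the Jacobi bracket of affine
functions. -/
def affineDualBracket (p q : AffineDualSection E F V) : AffineDualSection E F V :=
  (S.derivationBracket_mem_range_affFun p q).choose

theorem affFun_affineDualBracket (p q : AffineDualSection E F V) :
    affFun (S.affineDualBracket p q) =
      derivationBracket S.Λ.biderivation S.E.derivation (affFun p) (affFun q) :=
  (S.derivationBracket_mem_range_affFun p q).choose_spec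

theorem affineDualBracket_skew (p q : AffineDualSection E F V) :
    S.affineDualBracket p q = -S.affineDualBracket q p := affFun_injective <| by
  rw [map_neg, affFun_affineDualBracket, affFun_affineDualBracket, derivationBracket,
    derivationBracket, S.Λ.biderivation_skew]
  ring

theorem affineDualBracket_add (p q r : AffineDualSection E F V) :
    S.affineDualBracket p (q + r) = S.affineDualBracket p q + S.affineDualBracket p r :=
  affFun_injective <| by
  simp only [map_add, affFun_affineDualBracket, derivationBracket]
  ring

theorem affineDualBracket_smul (r : ℝ) (p q : AffineDualSection E F V) :
    S.affineDualBracket p (r • q) = r • S.affineDualBracket p q := affFun_injective <| by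
  simp only [map_smul, affFun_affineDualBracket, derivationBracket, Derivation.map_smul, smul_add,
    smul_sub, smul_mul_assoc, mul_smul_comm]

theorem affineDualBracket_smulSection_zero [Nontrivial F] {a : DualSection 𝓘(ℝ, E) F V}
    {f h : C^∞⟮𝓘(ℝ, E), M; ℝ⟯}
    (hh : basicFun h = S.Λ.biderivation (affFun (a, 0)) (basicFun f))
    (b : DualSection 𝓘(ℝ, E) F V) : S.affineDualBracket (a, 0) (smulSection f b, 0) =
      (smulSection f (S.affineDualBracket (a, 0) (b, 0)).1 + smulSection h b,
        f * (S.affineDualBracket (a, 0) (b, 0)).2) := affFun_injective <| by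
  rw [← add_zero (f * _), ← Prod.mk_add_mk, map_add, affFun_smulSection, affFun_smulSection_zero]
  simp only [affFun_affineDualBracket, derivationBracket, affFun_smulSection_zero,
    Derivation.leibniz, derivation_basicFun, smul_eq_mul, hh]
  ring

theorem jacobiator_affineDualBracket (p q r : AffineDualSection E F V) :
    jacobiator S.affineDualBracket p q r = 0 := affFun_injective <| by
  simp only [jacobiator, map_add, map_zero, affFun_affineDualBracket]
  exact S.jacobiator_eq_zero (affFun p) (affFun q) (affFun r)

theorem affineDualBracket_fst [Nontrivial F] (p q : AffineDualSection E F V) :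
    (S.affineDualBracket p q).1 = (S.affineDualBracket (p.1, 0) (q.1, 0)).1 := by
  obtain ⟨h, hh⟩ := sub_mem (add_mem (add_mem
    (S.biderivation_basicFun_mem_range_basicFun p.2 (q.1, 0))
    (S.biderivation_affFun_basicFun_mem_range_basicFun p.1 q.2))
    (mul_mem (basicFun.mem_range_self p.2) (S.derivation_affFun_mem_range_basicFun (q.1, 0))))
    (mul_mem (basicFun.mem_range_self q.2) (S.derivation_affFun_mem_range_basicFun (p.1, 0)))
  replace hh : basicFun h = S.Λ.biderivation (basicFun p.2) (affFun (q.1, 0))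
      + S.Λ.biderivation (affFun (p.1, 0)) (basicFun q.2)
      + basicFun p.2 * S.E.derivation (affFun (q.1, 0))
      - basicFun q.2 * S.E.derivation (affFun (p.1, 0)) := hh
  have hdiff : S.affineDualBracket p q =
      S.affineDualBracket (p.1, 0) (q.1, 0) + (0, h) := affFun_injective <| by
    rw [map_add, affFun_zero_left, hh, affFun_affineDualBracket, affFun_affineDualBracket,
      affFun_eq_add p, affFun_eq_add q]
    simp only [derivationBracket, map_add, Derivation.add_apply, derivation_basicFun,
      biderivation_basicFun_basicFun]
    ring
  rw [hdiff, Prod.fst_add, add_zero]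

theorem exists_lieAlgebroid [Nontrivial F] :
    ∃ L : LieAlgebroid 𝓘(ℝ, E) (F →L[ℝ] ℝ) (DualFiber V),
      (∀ a b, L.bracket a b = (S.affineDualBracket (a, 0) (b, 0)).1) ∧
        ∀ a f, S.Λ.biderivation (affFun (a, 0)) (basicFun f) = basicFun (L.rhoDerivation a f) := by
  obtain ⟨ρ, hρ⟩ := S.exists_anchor
  let L : LieAlgebroid 𝓘(ℝ, E) (F →L[ℝ] ℝ) (DualFiber V) :=
    { bracket := fun a b => (S.affineDualBracket (a, 0) (b, 0)).1
      anchor := ρ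
      bracket_add := fun a b c => by
        rw [← Prod.fst_add, ← affineDualBracket_add, Prod.mk_add_mk, add_zero]
      bracket_smul := fun r a b => by
        rw [← Prod.smul_fst, ← affineDualBracket_smul, Prod.smul_mk, smul_zero]
      bracket_skew := fun a b => congrArg Prod.fst (S.affineDualBracket_skew (a, 0) (b, 0))
      jacobi := fun a b c => by
        have h := congrArg Prod.fst (S.jacobiator_affineDualBracket (a, 0) (b, 0) (c, 0))
        simp only [jacobiator, Prod.fst_add, S.affineDualBracket_fst (S.affineDualBracket _ _)] at h
        exact h
      leibniz := fun a f b x => by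
        obtain ⟨h, hh⟩ := S.biderivation_affFun_basicFun_mem_range_basicFun a f
        have hx : h x = mvfderiv 𝓘(ℝ, E) f x (ρ x (a x)) :=
          (DFunLike.congr_fun hh ⟨x, 0⟩).trans (hρ a f ⟨x, 0⟩)
        rw [S.affineDualBracket_smulSection_zero hh, ← hx]
        rfl }
  exact ⟨L, fun _ _ => rfl, fun a f => ContMDiffMap.ext (hρ a f)⟩

theorem exists_skewBilinear [Nontrivial F] :
    ∃ P : SkewBilinear 𝓘(ℝ, E) (F →L[ℝ] ℝ) (DualFiber V),
      ∀ a b, P.toFun a b = -(S.affineDualBracket (a, 0) (b, 0)).2 :=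
  ⟨{ toFun := fun a b => -(S.affineDualBracket (a, 0) (b, 0)).2
     skew := fun a b => congrArg (- ·.2) (S.affineDualBracket_skew (a, 0) (b, 0))
     map_add := fun a b c => by
       rw [← neg_add, ← Prod.snd_add, ← affineDualBracket_add, Prod.mk_add_mk, add_zero]
     map_smul := fun a f b => by
       obtain ⟨h, hh⟩ := S.biderivation_affFun_basicFun_mem_range_basicFun a f
       rw [S.affineDualBracket_smulSection_zero hh, mul_neg] }, fun _ _ => rfl⟩

theorem exists_affineBracket_eq [Nontrivial F] :
    ∃ (L : LieAlgebroid 𝓘(ℝ, E) (F →L[ℝ] ℝ) (DualFiber V)) (X : Cₛ^∞⟮𝓘(ℝ, E); F, V⟯)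
      (P : SkewBilinear 𝓘(ℝ, E) (F →L[ℝ] ℝ) (DualFiber V)),
      ∀ p q, derivationBracket S.Λ.biderivation S.E.derivation (affFun p) (affFun q) =
        affFun (affineBracket L X P p q) := by
  obtain ⟨L, hL, hρ⟩ := S.exists_lieAlgebroid
  obtain ⟨X, hX⟩ := S.exists_cocycle
  obtain ⟨P, hP⟩ := S.exists_skewBilinear
  refine ⟨L, X, P, fun p q => ?_⟩
  have hlin := (S.affFun_affineDualBracket (p.1, 0) (q.1, 0)).symm
  rw [affFun_eq_add (S.affineDualBracket _ _), ← hL, ← neg_eq_iff_eq_neg.2 (hP p.1 q.1),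
    derivationBracket, hX, hX] at hlin
  rw [affFun_eq_add p, affFun_eq_add q, affineBracket_apply, affFun_eq_add (L.bracket _ _, _)]
  simp only [derivationBracket, map_add, map_sub, map_mul, Derivation.add_apply,
    derivation_basicFun, biderivation_basicFun_basicFun, hX, hρ,
    S.Λ.biderivation_skew (basicFun p.2)]
  linear_combination hlin

end StronglyAffineJacobi

/-! ### The correspondence -/

section JacobiStructureExt

variable {E : Type*} [NormedAddCommGroup E] [NormedSpace ℝ E]
  {H : Type*} [TopologicalSpace H] {J : ModelWithCorners ℝ E H} [J.Boundaryless]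
  {N : Type*} [TopologicalSpace N] [ChartedSpace H N] [IsManifold J ∞ N]

theorem IsCoordinateFamily.jacobiStructure_ext {𝒜 : Set C^∞⟮J, N; ℝ⟯}
    (h𝒜 : IsCoordinateFamily 𝒜) (hone : 1 ∈ 𝒜) {S S' : JacobiStructure J N}
    (h : ∀ f ∈ 𝒜, ∀ g ∈ 𝒜, derivationBracket S.Λ.biderivation S.E.derivation f g =
      derivationBracket S'.Λ.biderivation S'.E.derivation f g) : S = S' := by
  have hE : S.E = S'.E := by
    ext x : 1
    refine h𝒜.tangent_ext fun f hf => ?_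
    have hf1 := h f hf 1 hone
    simp only [derivationBracket, Derivation.map_one_eq_zero, mul_zero, add_zero, one_mul, zero_sub,
      neg_inj] at hf1
    exact DFunLike.congr_fun hf1 x
  have hΛ : S.Λ = S'.Λ := h𝒜.bivectorField_ext fun f hf g hg => by
    have hfg := h f hf g hg
    rw [derivationBracket, derivationBracket, hE, sub_left_inj, add_left_inj] at hfg
    exact DFunLike.congr_fun hfg
  exact JacobiStructure.ext hΛ hE

end JacobiStructureExt

section Correspondence

variable {E : Type*} [NormedAddCommGroup E] [NormedSpace ℝ E] [FiniteDimensional ℝ E]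
  {M : Type*} [TopologicalSpace M] [T2Space M] [ChartedSpace E M] [IsManifold 𝓘(ℝ, E) ∞ M]
  {F : Type*} [NormedAddCommGroup F] [NormedSpace ℝ F] [FiniteDimensional ℝ F]
  {V : M → Type*} [TopologicalSpace (TotalSpace F V)]
  [∀ x, AddCommGroup (V x)] [∀ x, Module ℝ (V x)] [∀ x, TopologicalSpace (V x)]
  [FiberBundle F V] [VectorBundle ℝ F V] [ContMDiffVectorBundle ∞ F V 𝓘(ℝ, E)]

theorem eq_of_affineBracket_eq {L L' : LieAlgebroid 𝓘(ℝ, E) (F →L[ℝ] ℝ) (DualFiber V)}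
    {X X' : Cₛ^∞⟮𝓘(ℝ, E); F, V⟯} {P P' : SkewBilinear 𝓘(ℝ, E) (F →L[ℝ] ℝ) (DualFiber V)}
    (h : ∀ p q, affineBracket L X P p q = affineBracket L' X' P' p q) :
    L = L' ∧ X = X' ∧ P = P' := by
  have hsnd := fun p q => congrArg Prod.snd (h p q)
  simp only [affineBracket_apply] at hsnd
  have hbracket : L.bracket = L'.bracket := funext₂ fun a b => congrArg Prod.fst (h (a, 0) (b, 0))
  have hP : P.toFun = P'.toFun := funext₂ fun a b => by
    simpa using hsnd (a, 0) (b, 0)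
  have hX : ∀ a, pairingHom X a = pairingHom X' a := fun a => by
    simpa [hP] using hsnd (a, 0) (0, 1)
  have hrho : ∀ a f, L.rhoDerivation a f = L'.rhoDerivation a f := fun a f => by
    simpa [hP, hX] using hsnd (a, 0) (0, f)
  refine ⟨LieAlgebroid.ext hbracket ?_, ?_, SkewBilinear.ext hP⟩
  · ext x w : 2
    obtain ⟨a, rfl⟩ := exists_section_apply_eq 𝓘(ℝ, E) (F →L[ℝ] ℝ) w
    exact isCoordinateFamily_univ.tangent_ext fun f _ => DFunLike.congr_fun (hrho a f) x
  · ext x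
    exact eq_of_forall_dualSection (I := 𝓘(ℝ, E)) (G := F) fun a => DFunLike.congr_fun (hX a) x

variable [∀ x, IsTopologicalAddGroup (V x)] [∀ x, ContinuousSMul ℝ (V x)] [Nontrivial F]

namespace TwistedJacobiAlgebroid

theorem toStronglyAffine_bracket (D : TwistedJacobiAlgebroid 𝓘(ℝ, E) F V)
    (p q : AffineDualSection E F V) :
    derivationBracket D.toStronglyAffine.Λ.biderivation D.toStronglyAffine.E.derivation
      (affFun p) (affFun q) = affFun (affineBracket D.toLieAlgebroid D.X₀ D.P₀ p q) :=
  derivationBracket_affFun D.toLieAlgebroid D.X₀ D.P₀ p q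

theorem toStronglyAffine_injective : Function.Injective
    (toStronglyAffine : TwistedJacobiAlgebroid 𝓘(ℝ, E) F V → StronglyAffineJacobi 𝓘(ℝ, E) F V) := by
  intro D D' h
  have hbracket : ∀ p q, affineBracket D.toLieAlgebroid D.X₀ D.P₀ p q =
      affineBracket D'.toLieAlgebroid D'.X₀ D'.P₀ p q := fun p q => affFun_injective <| by
    rw [← toStronglyAffine_bracket, h, toStronglyAffine_bracket]
  obtain ⟨hL, hX, hP⟩ := eq_of_affineBracket_eq hbracket
  exact TwistedJacobiAlgebroid.ext (congrArg LieAlgebroid.bracket hL)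
    (congrArg LieAlgebroid.anchor hL) hX hP

theorem toStronglyAffine_surjective : Function.Surjective
    (toStronglyAffine : TwistedJacobiAlgebroid 𝓘(ℝ, E) F V → StronglyAffineJacobi 𝓘(ℝ, E) F V) := by
  intro S
  obtain ⟨L, X, P, h⟩ := S.exists_affineBracket_eq
  have hjacobi : ∀ p q r, jacobiator (affineBracket L X P · ·) p q r = 0 := fun p q r =>
    affFun_injective <| by
      simp only [jacobiator, map_add, ← h]
      exact (S.jacobiator_eq_zero _ _ _).trans (map_zero affFun).symm
  obtain ⟨hcocycle, htwist⟩ := (jacobiator_affineBracket_eq_zero_iff L X P).1 hjacobi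
  refine ⟨⟨⟨L, X, hcocycle⟩, P, htwist⟩, ?_⟩
  suffices hS : affineJacobi L X P hcocycle htwist = S.toJacobiStructure from
    StronglyAffineJacobi.ext (congrArg JacobiStructure.Λ hS) (congrArg JacobiStructure.E hS)
  refine isCoordinateFamily_range_affFun.jacobiStructure_ext
    ⟨(0, 1), ContMDiffMap.ext fun _ => zero_add 1⟩ ?_
  rintro _ ⟨p, rfl⟩ _ ⟨q, rfl⟩
  exact (derivationBracket_affFun L X P p q).trans (h p q).symm

variable (E F V) in
/-- The correspondence between Jacobi algebroid structures on `A^*` twisted by a 2-section of `A`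
and strongly-affine Jacobi structures on `A`. -/
def equivStronglyAffine :
    TwistedJacobiAlgebroid 𝓘(ℝ, E) F V ≃ StronglyAffineJacobi 𝓘(ℝ, E) F V :=
  Equiv.ofBijective toStronglyAffine ⟨toStronglyAffine_injective, toStronglyAffine_surjective⟩

end TwistedJacobiAlgebroid

end Correspondence

section TrivialStructures

variable {E : Type*} [NormedAddCommGroup E] [NormedSpace ℝ E]
  {H : Type*} [TopologicalSpace H] {I : ModelWithCorners ℝ E H}
  {M : Type*} [TopologicalSpace M] [ChartedSpace H M]
  {G : Type*} [NormedAddCommGroup G] [NormedSpace ℝ G]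
  {W : M → Type*} [TopologicalSpace (TotalSpace G W)]
  [∀ x, AddCommGroup (W x)] [∀ x, Module ℝ (W x)] [∀ x, TopologicalSpace (W x)]
  [FiberBundle G W] [VectorBundle ℝ G W]

instance : Zero (SkewBilinear I G W) where
  zero :=
    { toFun := fun _ _ => 0
      skew := fun _ _ => neg_zero.symm
      map_add := fun _ _ _ => (add_zero 0).symm
      map_smul := fun _ _ _ => (mul_zero _).symm }

@[simp]
theorem SkewBilinear.zero_toFun (a b : Cₛ^∞⟮I; G, W⟯) :
    (0 : SkewBilinear I G W).toFun a b = 0 := rfl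

instance : Neg (SkewBilinear I G W) where
  neg P :=
    { toFun := fun a b => -P.toFun a b
      skew := fun a b => by rw [P.skew]
      map_add := fun a b c => by rw [P.map_add, neg_add]
      map_smul := fun a f b => by rw [P.map_smul, mul_neg] }

variable [IsManifold I ∞ M]

theorem LieAlgebroid.rho_zero (L : LieAlgebroid I G W) (a : Cₛ^∞⟮I; G, W⟯) (x : M) :
    L.rho a 0 x = 0 := by
  change mvfderiv I (fun _ => (0 : ℝ)) x _ = 0
  rw [mvfderiv_const]
  rfl

variable [∀ x, IsTopologicalAddGroup (W x)] [∀ x, ContinuousSMul ℝ (W x)]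

variable (I G W) in
/-- The Lie algebroid structure with zero bracket and zero anchor. -/
def LieAlgebroid.trivial : LieAlgebroid I G W where
  bracket _ _ := 0
  anchor := 0
  bracket_add _ _ _ := (add_zero 0).symm
  bracket_smul r _ _ := (smul_zero r).symm
  bracket_skew _ _ := neg_zero.symm
  jacobi _ _ _ := by rw [add_zero, add_zero]
  leibniz a f b x := by
    change (0 : W x) = f x • (0 : W x) + (mvfderiv I f x 0 : ℝ) • b x
    rw [map_zero, smul_zero, zero_smul, add_zero]

end TrivialStructures

section LinearFunctions

variable {E : Type*} [NormedAddCommGroup E] [NormedSpace ℝ E]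
  {M : Type*} [TopologicalSpace M] [ChartedSpace E M]
  {F : Type*} [NormedAddCommGroup F] [NormedSpace ℝ F]
  {V : M → Type*} [TopologicalSpace (TotalSpace F V)]
  [∀ x, AddCommGroup (V x)] [∀ x, Module ℝ (V x)] [∀ x, TopologicalSpace (V x)]
  [FiberBundle F V] [VectorBundle ℝ F V]

theorem pairing_zero (a : DualSection 𝓘(ℝ, E) F V) : pairing 0 a = 0 :=
  funext fun x => map_zero (a x)

theorem coe_affFun_zero_right (a : DualSection 𝓘(ℝ, E) F V) : ⇑(affFun (a, 0)) = linFun a :=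
  funext fun _ => add_zero _

end LinearFunctions

section LinearBivectorFields

variable {E : Type*} [NormedAddCommGroup E] [NormedSpace ℝ E] [FiniteDimensional ℝ E]
  {M : Type*} [TopologicalSpace M] [T2Space M] [ChartedSpace E M] [IsManifold 𝓘(ℝ, E) ∞ M]
  {F : Type*} [NormedAddCommGroup F] [NormedSpace ℝ F] [FiniteDimensional ℝ F]
  {V : M → Type*} [TopologicalSpace (TotalSpace F V)]
  [∀ x, AddCommGroup (V x)] [∀ x, Module ℝ (V x)] [∀ x, TopologicalSpace (V x)]
  [FiberBundle F V] [VectorBundle ℝ F V] [ContMDiffVectorBundle ∞ F V 𝓘(ℝ, E)]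

section LinearFunctionsSuffice

variable [Nontrivial F]

theorem eq_zero_of_forall_mul_linFun {h : C^∞⟮𝓘(ℝ, E).prod 𝓘(ℝ, F), TotalSpace F V; ℝ⟯}
    (hh : ∀ a : DualSection 𝓘(ℝ, E) F V, h * affFun (a, 0) = 0) : h = 0 := by
  ext v
  have := (VectorBundle.continuousLinearEquivAt ℝ F V v.proj).toEquiv.nontrivial
  obtain ⟨w, hw⟩ := exists_ne (0 : V v.proj)
  by_contra hv
  refine hw (eq_of_forall_dualSection (I := 𝓘(ℝ, E)) (G := F) fun a => ?_)
  have hlin : affFun (a, 0) v = 0 :=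
    (mul_eq_zero.1 (DFunLike.congr_fun (hh a) v)).resolve_left hv
  have hderiv := mvfderiv_smoothMap_mul h (affFun (a, 0)) v
  rw [hlin, zero_smul, add_zero, hh] at hderiv
  have hvert := DFunLike.congr_fun hderiv (verticalLift 𝓘(ℝ, E) F v w)
  change mvfderiv _ (fun _ => (0 : ℝ)) v _ = h v * mvfderiv _ _ v _ at hvert
  rw [mvfderiv_const, mvfderiv_affFun_verticalLift] at hvert
  exact ((mul_eq_zero.1 hvert.symm).resolve_left hv).trans (map_zero (a v.proj)).symm

theorem derivation_affFun_ext
    {D D' : Derivation ℝ C^∞⟮𝓘(ℝ, E).prod 𝓘(ℝ, F), TotalSpace F V; ℝ⟯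
      C^∞⟮𝓘(ℝ, E).prod 𝓘(ℝ, F), TotalSpace F V; ℝ⟯}
    (h : ∀ a : DualSection 𝓘(ℝ, E) F V, D (affFun (a, 0)) = D' (affFun (a, 0)))
    (p : AffineDualSection E F V) : D (affFun p) = D' (affFun p) := by
  have hbasic : D (basicFun p.2) - D' (basicFun p.2) = 0 :=
    eq_zero_of_forall_mul_linFun fun a => by
      have hleibniz := h (smulSection p.2 a)
      rw [affFun_smulSection_zero, Derivation.leibniz, Derivation.leibniz, h a, add_right_inj,
        smul_eq_mul, smul_eq_mul] at hleibniz
      rw [sub_mul, mul_comm, hleibniz, mul_comm, sub_self]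
  rw [affFun_eq_add, map_add, map_add, h, sub_eq_zero.1 hbasic]

theorem bivectorField_ext_linFun
    {Λ Λ' : BivectorField (𝓘(ℝ, E).prod 𝓘(ℝ, F)) (TotalSpace F V)}
    (h : ∀ (a b : DualSection 𝓘(ℝ, E) F V) v,
      Λ.onFun (linFun a) (linFun b) v = Λ'.onFun (linFun a) (linFun b) v) : Λ = Λ' := by
  have hlin : ∀ (a : DualSection 𝓘(ℝ, E) F V) q,
      Λ.biderivation (affFun (a, 0)) (affFun q) = Λ'.biderivation (affFun (a, 0)) (affFun q) :=
    fun a => derivation_affFun_ext fun b => ContMDiffMap.ext fun v => by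
      change Λ.onFun (affFun (a, 0)) (affFun (b, 0)) v = Λ'.onFun (affFun (a, 0)) (affFun (b, 0)) v
      rw [coe_affFun_zero_right, coe_affFun_zero_right, h]
  refine isCoordinateFamily_range_affFun.bivectorField_ext ?_
  rintro _ ⟨p, rfl⟩ _ ⟨q, rfl⟩
  refine DFunLike.congr_fun (derivation_affFun_ext (D := Λ.biderivation (affFun p))
    (D' := Λ'.biderivation (affFun p)) (fun b => ?_) q)
  rw [Λ.biderivation_skew, Λ'.biderivation_skew, hlin]

end LinearFunctionsSuffice

theorem affineBivector_onFun (L : LieAlgebroid 𝓘(ℝ, E) (F →L[ℝ] ℝ) (DualFiber V))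
    (X : Cₛ^∞⟮𝓘(ℝ, E); F, V⟯) (P : SkewBilinear 𝓘(ℝ, E) (F →L[ℝ] ℝ) (DualFiber V))
    (p q : AffineDualSection E F V) (v : TotalSpace F V) :
    (affineBivector L X P).onFun (affFun p) (affFun q) v =
      linFun (L.bracket p.1 q.1) v - P.toFun p.1 q.1 v.proj
        + (L.rho p.1 q.2 v.proj - L.rho q.1 p.2 v.proj)
        + (linFun p.1 v * pairing X q.1 v.proj - linFun q.1 v * pairing X p.1 v.proj) := by
  refine (DFunLike.congr_fun (affineBivector_biderivation L X P p q) v).trans ?_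
  change linFun (L.bracket p.1 q.1) v + (-P.toFun p.1 q.1 v.proj - p.2 v.proj * pairing X q.1 v.proj
      + q.2 v.proj * pairing X p.1 v.proj - L.rho q.1 p.2 v.proj + L.rho p.1 q.2 v.proj)
    + (linFun p.1 v + p.2 v.proj) * pairing X q.1 v.proj
    - (linFun q.1 v + q.2 v.proj) * pairing X p.1 v.proj = _
  ring

theorem affineBivector_onFun_linFun (L : LieAlgebroid 𝓘(ℝ, E) (F →L[ℝ] ℝ) (DualFiber V))
    (P : SkewBilinear 𝓘(ℝ, E) (F →L[ℝ] ℝ) (DualFiber V)) (a b : DualSection 𝓘(ℝ, E) F V)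
    (v : TotalSpace F V) : (affineBivector L 0 P).onFun (linFun a) (linFun b) v =
      linFun (L.bracket a b) v - P.toFun a b v.proj := by
  rw [← coe_affFun_zero_right, ← coe_affFun_zero_right, affineBivector_onFun, pairing_zero,
    pairing_zero, ContMDiffMap.coe_zero, L.rho_zero, L.rho_zero]
  simp only [Pi.zero_apply, mul_zero, sub_zero, add_zero]

theorem negSectionLift_zero : negSectionLift (0 : Cₛ^∞⟮𝓘(ℝ, E); F, V⟯) = 0 := by
  ext v : 1
  refine isCoordinateFamily_range_affFun.tangent_ext ?_
  rintro _ ⟨p, rfl⟩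
  refine (DFunLike.congr_fun (negSectionLift_derivation 0 p) v).trans ?_
  change -pairing 0 p.1 v.proj = mvfderiv _ _ v 0
  rw [pairing_zero, map_zero, Pi.zero_apply, neg_zero]

section Existence

variable [Nontrivial F]

theorem isPoisson_affineBivector_zero (L : LieAlgebroid 𝓘(ℝ, E) (F →L[ℝ] ℝ) (DualFiber V)) :
    (affineBivector L 0 0).IsPoisson := by
  have hcocycle : ∀ a b x, L.d₁ (pairing 0) a b x = 0 := fun a b x => by
    simp only [LieAlgebroid.d₁, pairing_zero, L.rho_zero, Pi.zero_apply, sub_zero]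
  have htwist : ∀ a b c x, L.d₂ (fun s t => (0 : SkewBilinear _ _ _).toFun s t) a b c x =
      -wedge₁₂ (pairing 0) (fun s t => (0 : SkewBilinear _ _ _).toFun s t) a b c x :=
    fun a b c x => by
      simp only [LieAlgebroid.d₂, wedge₁₂, SkewBilinear.zero_toFun, ContMDiffMap.coe_zero,
        L.rho_zero, Pi.zero_apply, mul_zero, sub_zero, add_zero, neg_zero]
  intro f g h hf hg hh v
  have hact : ∀ k, VectorField.act (negSectionLift (0 : Cₛ^∞⟮𝓘(ℝ, E); F, V⟯)) k v = 0 := fun k => by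
    rw [negSectionLift_zero]
    exact map_zero (mvfderiv _ k v)
  refine ((affineJacobi L 0 0 hcocycle htwist).schouten_self f g h hf hg hh v).trans ?_
  change -2 * VectorField.wedge (negSectionLift 0) _ f g h v = 0
  rw [VectorField.wedge, hact, hact, hact]
  ring

theorem isInducedPoisson_affineBivector [∀ x, IsTopologicalAddGroup (V x)]
    [∀ x, ContinuousSMul ℝ (V x)] (L : LieAlgebroid 𝓘(ℝ, E) (F →L[ℝ] ℝ) (DualFiber V)) :
    L.IsInducedPoisson (affineBivector L 0 0) := by
  have hlin : ∀ a b v, (affineBivector L 0 0).onFun (linFun a) (linFun b) v =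
      linFun (L.bracket a b) v := fun a b v =>
    (affineBivector_onFun_linFun L 0 a b v).trans (sub_zero _)
  refine ⟨isPoisson_affineBivector_zero L, fun f g hf hg => ?_, hlin⟩
  obtain ⟨a, rfl⟩ := hf.exists_linFun_eq
  obtain ⟨b, rfl⟩ := hg.exists_linFun_eq
  rw [funext (hlin a b)]
  exact isLinearFun_linFun _

end Existence

theorem affineBivector_trivial_onFun (P : SkewBilinear 𝓘(ℝ, E) (F →L[ℝ] ℝ) (DualFiber V))
    (p q : AffineDualSection E F V) (v : TotalSpace F V) :
    (affineBivector (LieAlgebroid.trivial _ _ _) 0 (-P)).onFun (affFun p) (affFun q) v =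
      P.toFun p.1 q.1 v.proj := by
  have hrho : ∀ (a : DualSection 𝓘(ℝ, E) F V) (f : M → ℝ),
      (LieAlgebroid.trivial 𝓘(ℝ, E) (F →L[ℝ] ℝ) (DualFiber V)).rho a f v.proj = 0 :=
    fun _ f => map_zero (mvfderiv 𝓘(ℝ, E) f v.proj)
  rw [affineBivector_onFun, pairing_zero, pairing_zero, hrho, hrho]
  change 0 - -P.toFun p.1 q.1 v.proj + (0 - 0) + (linFun p.1 v * 0 - linFun q.1 v * 0) = _
  ring

theorem isVerticalLift_affineBivector (P : SkewBilinear 𝓘(ℝ, E) (F →L[ℝ] ℝ) (DualFiber V)) :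
    P.IsVerticalLift (affineBivector (LieAlgebroid.trivial _ _ _) 0 (-P)) := by
  refine ⟨fun a b v => ?_, fun f g _ v => ?_⟩
  · rw [← coe_affFun_zero_right, ← coe_affFun_zero_right, affineBivector_trivial_onFun]
  · obtain ⟨_, ⟨q, rfl⟩, hq⟩ := isCoordinateFamily_range_affFun.exists_mvfderiv_eq v
      (mvfderiv (𝓘(ℝ, E).prod 𝓘(ℝ, F)) g v)
    have h := affineBivector_trivial_onFun P (0, f) q v
    rw [affFun_zero_left, BivectorField.onFun, hq] at h
    exact h.trans (DFunLike.congr_fun (P.toLinear.map_zero₂ q.1) v.proj)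

variable [Nontrivial F]

theorem SkewBilinear.existsUnique_isVerticalLift
    (P : SkewBilinear 𝓘(ℝ, E) (F →L[ℝ] ℝ) (DualFiber V)) : ∃! B, P.IsVerticalLift B :=
  ⟨_, isVerticalLift_affineBivector P, fun _ hB => bivectorField_ext_linFun fun a b v =>
    (hB.1 a b v).trans ((isVerticalLift_affineBivector P).1 a b v).symm⟩

variable [∀ x, IsTopologicalAddGroup (V x)] [∀ x, ContinuousSMul ℝ (V x)]

theorem LieAlgebroid.existsUnique_isInducedPoisson
    (L : LieAlgebroid 𝓘(ℝ, E) (F →L[ℝ] ℝ) (DualFiber V)) : ∃! B, L.IsInducedPoisson B :=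
  ⟨_, isInducedPoisson_affineBivector L, fun _ hB => bivectorField_ext_linFun fun a b v =>
    (hB.2.2 a b v).trans ((isInducedPoisson_affineBivector L).2.2 a b v).symm⟩

theorem affineBivector_form {L : LieAlgebroid 𝓘(ℝ, E) (F →L[ℝ] ℝ) (DualFiber V)}
    (X : Cₛ^∞⟮𝓘(ℝ, E); F, V⟯) {P : SkewBilinear 𝓘(ℝ, E) (F →L[ℝ] ℝ) (DualFiber V)}
    {Λbar Pv : BivectorField (𝓘(ℝ, E).prod 𝓘(ℝ, F)) (TotalSpace F V)}
    (hΛbar : L.IsInducedPoisson Λbar) (hPv : P.IsVerticalLift Pv)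
    (v : TotalSpace F V) (α β : Cotangent (𝓘(ℝ, E).prod 𝓘(ℝ, F)) v) :
    (affineBivector L X P).form v α β = Λbar.form v α β - Pv.form v α β
      + (α (liouville 𝓘(ℝ, E) v) * β (sectionLift X v)
        - β (liouville 𝓘(ℝ, E) v) * α (sectionLift X v)) := by
  obtain rfl := L.existsUnique_isInducedPoisson.unique (isInducedPoisson_affineBivector L) hΛbar
  obtain rfl := P.existsUnique_isVerticalLift.unique (isVerticalLift_affineBivector P) hPv
  obtain ⟨_, ⟨p, rfl⟩, rfl⟩ := isCoordinateFamily_range_affFun.exists_mvfderiv_eq v α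
  obtain ⟨_, ⟨q, rfl⟩, rfl⟩ := isCoordinateFamily_range_affFun.exists_mvfderiv_eq v β
  have hX := affineBivector_onFun L X P p q v
  have hΛ := affineBivector_onFun L 0 0 p q v
  have hP := affineBivector_trivial_onFun P p q v
  rw [pairing_zero, pairing_zero, SkewBilinear.zero_toFun, ContMDiffMap.coe_zero] at hΛ
  simp only [BivectorField.onFun, Pi.zero_apply] at hX hΛ hP
  simp only [liouville, sectionLift, mvfderiv_affFun_verticalLift]
  rw [hX, hΛ, hP]
  simp only [linFun, pairing]
  ring

end LinearBivectorFields

end JacobiBundle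

end

theorem mainTheorem9
    {E : Type*} [NormedAddCommGroup E] [NormedSpace ℝ E] [FiniteDimensional ℝ E]
    {M : Type*} [TopologicalSpace M] [T2Space M] [ChartedSpace E M]
    [IsManifold 𝓘(ℝ, E) ∞ M]
    {F : Type*} [NormedAddCommGroup F] [NormedSpace ℝ F] [FiniteDimensional ℝ F]
    {V : M → Type*} [TopologicalSpace (TotalSpace F V)]
    [∀ x, AddCommGroup (V x)] [∀ x, Module ℝ (V x)] [∀ x, TopologicalSpace (V x)]
    [∀ x, IsTopologicalAddGroup (V x)] [∀ x, ContinuousSMul ℝ (V x)]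
    [FiberBundle F V] [VectorBundle ℝ F V] [ContMDiffVectorBundle ∞ F V 𝓘(ℝ, E)]
    (hrank : 0 < Module.finrank ℝ F) :
    -- the linear Poisson structure of a Lie algebroid on the dual, and the vertical lift of a
    -- skew bilinear map, exist and are unique
    (∀ L : JacobiBundle.LieAlgebroid 𝓘(ℝ, E) (F →L[ℝ] ℝ) (JacobiBundle.DualFiber V),
      ∃! B, L.IsInducedPoisson B) ∧
    (∀ P : JacobiBundle.SkewBilinear 𝓘(ℝ, E) (F →L[ℝ] ℝ) (JacobiBundle.DualFiber V),
      ∃! B, P.IsVerticalLift B) ∧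
    -- the one-to-one correspondence
    ∃ Φ : JacobiBundle.TwistedJacobiAlgebroid 𝓘(ℝ, E) F V ≃
        JacobiBundle.StronglyAffineJacobi 𝓘(ℝ, E) F V,
      ∀ D : JacobiBundle.TwistedJacobiAlgebroid 𝓘(ℝ, E) F V,
        -- `Λ_A = Λbar - P₀^v + Δ_A ∧ X₀^v`
        (∀ Λbar Pv, D.toLieAlgebroid.IsInducedPoisson Λbar → D.P₀.IsVerticalLift Pv →
          ∀ (v : TotalSpace F V) (α β : JacobiBundle.Cotangent (𝓘(ℝ, E).prod 𝓘(ℝ, F)) v),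
            (Φ D).Λ.form v α β = Λbar.form v α β - Pv.form v α β
              + (α (JacobiBundle.liouville 𝓘(ℝ, E) v) * β (JacobiBundle.sectionLift D.X₀ v)
                - β (JacobiBundle.liouville 𝓘(ℝ, E) v)
                  * α (JacobiBundle.sectionLift D.X₀ v))) ∧
        -- `E_A = -X₀^v`
        (∀ v : TotalSpace F V, (Φ D).E v = -JacobiBundle.sectionLift D.X₀ v) ∧
        -- the Jacobi bracket of the affine functions `ι_a + f ∘ π` and `ι_b + g ∘ π`
        ∀ (a b : JacobiBundle.DualSection 𝓘(ℝ, E) F V) (f g : C^∞⟮𝓘(ℝ, E), M; ℝ⟯)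
          (v : TotalSpace F V),
          (Φ D).bracket (fun u => JacobiBundle.linFun a u + f u.proj)
              (fun u => JacobiBundle.linFun b u + g u.proj) v
            = JacobiBundle.linFun (D.bracket a b) v
              + (-D.P₀.toFun a b v.proj
                - f v.proj * JacobiBundle.pairing D.X₀ b v.proj
                + g v.proj * JacobiBundle.pairing D.X₀ a v.proj
                - D.rho b f v.proj + D.rho a g v.proj) := by
  have : Nontrivial F := Module.nontrivial_of_finrank_pos hrank
  refine ⟨fun L => L.existsUnique_isInducedPoisson, fun P => P.existsUnique_isVerticalLift,
    JacobiBundle.TwistedJacobiAlgebroid.equivStronglyAffine E F V, fun D =>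
      ⟨fun Λbar Pv hΛbar hPv => ?_, fun v => rfl, fun a b f g => ?_⟩⟩
  · exact JacobiBundle.affineBivector_form D.X₀ hΛbar hPv
  · exact DFunLike.congr_fun (D.toStronglyAffine_bracket (a, f) (b, g))
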